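/- **Primitive elements for $N_++N_-=2$ in $D=6$.** Let $(t,6-t)$ be one of the signatures $(1,5),(3,3),(5,1)$ and let $\eta_{ab}=\eta^{ab}$ be the diagonal matrix with $t$ entries $-1$ followed by $6-t$ entries $+1$. Let $\gamma^1,\dots,\gamma^6$ be complex $8\times 8$ matrices with $\gamma^a\gamma^b+\gamma^b\gamma^a=2\eta^{ab}\mathbf 1$, put $\gamma_a=\eta_{ab}\gamma^b$, let $\hat\gamma$ be a chirality matrix ($\hat\gamma^2=\mathbf 1$, $\hat\gamma\gamma^a=-\gamma^a\hat\gamma$), and let $C$ be an invertible charge conjugation matrix, $\gamma_a^\top=-C\gamma_aC^{-1}$, $C^\top=C$. Let $\gamma_{a_1\dots a_p}$ denote the totally antisymmetrized product of $\gamma_{a_1},\dots,\gamma_{a_p}$ (with weight $1/p!$). Let $\xi_1,\xi_2$ be two commuting Weyl spinor ghosts (row spinors) of the same chirality: either $\xi_i\hat\gamma=\xi_i$ for $i=1,2$ (the case $(N_+,N_-)=(2,0)$) or $\xi_i\hat\gamma=-\xi_i$ for $i=1,2$ (the case $(N_+,N_-)=(0,2)$); each $\xi_i=(\xi_i^\alpha)_{\alpha=1,\dots,8}$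 thus has four independent components, and the components of $\xi_1,\xi_2$ generate a polynomial ring over $\mathbb C$ in eight variables. Let $c^1,\dots,c^6$ be anticommuting translation ghosts commuting with the $\xi$'s, let $\Omega$ be the algebra of polynomials with complex coefficients in the $c^a$ and the $\xi_i^\alpha$, and let $$b=-\tfrac12\,M^{ij}\,(\gamma^aC^{-1})_{\alpha\beta}\,\xi_i^\alpha\xi_j^\beta\,\frac{\partial}{\partial c^a},\qquad M=\sigma_2=\begin{pmatrix}0&-\mathrm i\\ \mathrm i&0\end{pmatrix},$$ where here and below repeated indices are summed. Write $\omega_1\sim\omega_2$ if $\omega_1-\omega_2=b\,\omega_3$ for some $\omega_3\in\Omega$, and set $$\vartheta_i^\alpha=c^a(\xi_i\gamma_a)^\alpha,\qquad \Theta^{(3)}_{ij}=\tfrac1{3!}\,c^{a_1}c^{a_2}c^{a_3}\,\xi_i\gamma_{a_1a_2a_3}C^{-1}\xi_j^\top,\qquad \Theta^{(3)}_{ij,a}=\frac{\partial\Theta^{(3)}_{ij}}{\partial c^a}.$$ Then for every $\omega\in\Omega$: $b\,\omega=0$ if and only if there are polynomials $p_3^{ij},\,p_2^{ija},\,p^i_\alpha,\,p_0$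 ($i,j\in\{1,2\}$, $a\in\{1,\dots,6\}$, $\alpha\in\{1,\dots,8\}$) in the components of $\xi_1,\xi_2$ such that $$\omega\sim\Theta^{(3)}_{ij}\,p_3^{ij}(\xi)+\Theta^{(3)}_{ij,a}\,p_2^{ija}(\xi)+\vartheta_i^\alpha\,p^i_\alpha(\xi)+p_0(\xi).$$ In particular, every such combination, with arbitrary polynomials, is a cocycle. -/

import Mathlib

open scoped Matrix Nat

namespace SusyCohomology

noncomputable section

/-- The matrix `η_{ab} = η^{ab}` is diagonal; these are its entries in signature `(t, 6 - t)`. -/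
def metric (t : ℕ) (a : Fin 6) : ℂ := if (a : ℕ) < t then -1 else 1

/-- A spinor representation in six dimensions with signature `(t, 6 - t)`: gamma matrices `γ^a`,
the chirality matrix (fixed up to sign by the last two laws; it is a multiple of `γ^1 ⋯ γ^6`)
and a charge conjugation matrix with `γ_aᵀ = - C γ_a C⁻¹` and `Cᵀ = C`. -/
structure SpinorRep (t : ℕ) where
  gamma : Fin 6 → Matrix (Fin 8) (Fin 8) ℂ
  chir : Matrix (Fin 8) (Fin 8) ℂ
  charge : Matrix (Fin 8) (Fin 8) ℂ
  clifford : ∀ a b, gamma a * gamma b + gamma b * gamma a =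
    if a = b then (2 * metric t a) • (1 : Matrix (Fin 8) (Fin 8) ℂ) else 0
  chir_anticomm : ∀ a, chir * gamma a = -(gamma a * chir)
  chir_sq : chir * chir = 1
  charge_isUnit : IsUnit charge.det
  charge_conj : ∀ a, (gamma a)ᵀ = -(charge * gamma a * charge⁻¹)
  charge_symm : chargeᵀ = charge

/-- Polynomials in the independent components of two Weyl spinor ghosts of equal chirality:
the variable `(i, s)` is the `s`-th of the four independent components of `ξ_i`. -/
abbrev GhostPoly : Type := MvPolynomial (Fin 2 × Fin 4) ℂ

/-- The space `Ω` of polynomials in the commuting supersymmetry ghosts and the anticommuting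
translation ghosts `c^1, …, c^6`. -/
abbrev GhostAlgebra : Type := ExteriorAlgebra GhostPoly (Fin 6 → GhostPoly)

/-- The translation ghost `c^a`. -/
def transGhost (a : Fin 6) : GhostAlgebra :=
  ExteriorAlgebra.ι GhostPoly (Pi.single a (1 : GhostPoly))

/-- The (left, odd) derivative `∂/∂c^a`: the antiderivation over the ring of polynomials in the
supersymmetry ghosts with `∂c^b/∂c^a = δ_a^b`. -/
def transDeriv (a : Fin 6) : GhostAlgebra →ₗ[GhostPoly] GhostAlgebra :=
  CliffordAlgebra.contractLeft
    (LinearMap.proj a : (Fin 6 → GhostPoly) →ₗ[GhostPoly] GhostPoly)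

/-- The matrix `M` for two supersymmetries, i.e. the second Pauli matrix. -/
def sigma2 : Matrix (Fin 2) (Fin 2) ℂ := !![0, -Complex.I; Complex.I, 0]

namespace SpinorRep

variable {t : ℕ} (G : SpinorRep t)

/-- Gamma matrices with lowered index, `γ_a = η_{ab} γ^b`. -/
def gammaLow (a : Fin 6) : Matrix (Fin 8) (Fin 8) ℂ := metric t a • G.gamma a

/-- The antisymmetrized product `γ_{a_1 … a_p}`. -/
def gammaAsym {p : ℕ} (a : Fin p → Fin 6) : Matrix (Fin 8) (Fin 8) ℂ :=
  (p ! : ℂ)⁻¹ • ∑ σ : Equiv.Perm (Fin p),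
    ((Equiv.Perm.sign σ : ℤ) : ℂ) • (List.ofFn fun k => G.gammaLow (a (σ k))).prod

/-- The space of row spinors of chirality `ε`: those `ψ` with `ψ chir = ε ψ`. -/
def weylSpinors (ε : ℤˣ) : Submodule ℂ (Fin 8 → ℂ) :=
  Module.End.eigenspace (Matrix.vecMulLinear G.chir) (((ε : ℤ) : ℂ))

variable {G} {ε : ℤˣ} (e : Module.Basis (Fin 4) ℂ (G.weylSpinors ε))

/-- The component `ξ_i^α` of the supersymmetry ghost `ξ_i`, the generic row spinor of chirality
`ε`, written in terms of its independent components with respect to the basis `e`. -/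
def susyGhost (i : Fin 2) (α : Fin 8) : GhostPoly :=
  ∑ s : Fin 4, MvPolynomial.C ((e s : Fin 8 → ℂ) α) * MvPolynomial.X (i, s)

/-- The spinor bilinear `ξ_i A C⁻¹ ξ_jᵀ` for a matrix `A`. -/
def bilin (i j : Fin 2) (A : Matrix (Fin 8) (Fin 8) ℂ) : GhostPoly :=
  ∑ α : Fin 8, ∑ β : Fin 8,
    MvPolynomial.C ((A * G.charge⁻¹) α β) * susyGhost e i α * susyGhost e j β

/-- The coboundary operator
`b = -1/2 M^{ij} (γ^a C⁻¹)_{αβ} ξ_i^α ξ_j^β ∂/∂c^a`. -/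
def cobdry : GhostAlgebra →ₗ[GhostPoly] GhostAlgebra :=
  ∑ a : Fin 6,
    (∑ i : Fin 2, ∑ j : Fin 2,
      MvPolynomial.C (-(1 / 2 : ℂ) * sigma2 i j) * bilin e i j (G.gamma a)) • transDeriv a

/-- Equivalence in the cohomology of `b`. -/
def Equivalent (ω₁ ω₂ : GhostAlgebra) : Prop :=
  ∃ ω₃ : GhostAlgebra, ω₁ - ω₂ = cobdry e ω₃

/-- `ϑ_i^α = c^a (ξ_i γ_a)^α`. -/
def vartheta (i : Fin 2) (α : Fin 8) : GhostAlgebra :=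
  ∑ a : Fin 6,
    (∑ β : Fin 8, MvPolynomial.C (G.gammaLow a β α) * susyGhost e i β) • transGhost a

/-- `Θ^{(p)}_{ij} = 1/p! c^{a_1} ⋯ c^{a_p} ξ_i γ_{a_1 … a_p} C⁻¹ ξ_jᵀ`. -/
def Theta (p : ℕ) (i j : Fin 2) : GhostAlgebra :=
  ∑ a : Fin p → Fin 6,
    (MvPolynomial.C ((p ! : ℂ)⁻¹) * bilin e i j (G.gammaAsym a)) •
      (List.ofFn fun k => transGhost (a k)).prod

/-- `Θ^{(p)}_{ij,a} = ∂Θ^{(p)}_{ij}/∂c^a`. -/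
def ThetaDeriv (p : ℕ) (i j : Fin 2) (a : Fin 6) : GhostAlgebra :=
  transDeriv a (Theta e p i j)

end SpinorRep

end

end SusyCohomology

open SusyCohomology SusyCohomology.SpinorRep

open scoped Matrix Nat
open SusyCohomology SusyCohomology.SpinorRep

namespace SusyCohomology

noncomputable section

/-! ### Block minors of the generic `2 × 4` matrix and the Segre parametrization -/

section

open MvPolynomial

/-! In suitable coordinates the theorem computes the cycles of the Koszul complex on the six `2 × 2`
minors of the generic `2 × 4` matrix whose rows are `ξ₁` and `ξ₂`. On Weyl spinors of one chirality
the matrices `γ^a C⁻¹` become antisymmetric `4 × 4` matrices, orthogonal for the Pfaffian form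
(`exists_weyl_coords`). Since `σ₂` is antisymmetric, only the antisymmetric pairing of the two
ghosts survives, and after a constant change of basis of the translation ghosts `b` contracts each
new generator to one minor (`cobdry_eq_contract`, `sum_minor_ghostFrame`). The elements `ϑ` and `Θ`
turn into explicit cycles `linForm` and `cubicForm`, up to invertible constants.

To find all cycles, split the columns into `{0, 1}` and `{2, 3}`. The two block minors form a
regular sequence. Their quotient ring embeds by `segre` into a polynomial ring in column and row
variables; the image is the part of bidegree zero, where column degree equals row degree in each
block (`exists_of_segre_eq_zero`, `exists_segre_eq_wtComp_zero`). There the other four minors become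
one common nonzero factor times products `colVar s * colVar t`. Cancelling the factor turns the
cycle equations into monomial syzygies. Their coefficients have negative weight, so they are
divisible by row variables, and this leaves finitely many generators.

For a cycle of the full complex, the part free of the two block generators is, modulo the block
minors, a cycle for the mixed minors. `exists_segre4_eq` matches this leading part with that of a
known cycle: constants in degree zero, `ϑ` in degree one, derivatives of `Θ` in degree two, `Θ` in
degree three, nothing in degree four, all up to boundaries. Once the leading parts agree modulo the
block minors, regularity makes the difference a boundary (`mem_of_cone_cone_eq_zero`).
`mem_of_contract_eq_zero` assembles this. Conversely, all listed elements are cycles because the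
basic ones are, `b` is linear over the ghost polynomials, and `b` anticommutes with `∂/∂c^a`. -/

/-- The `2 × 2` minor of the generic `2 × 4` matrix with columns `s` and `t`. -/
def minor (s t : Fin 4) : GhostPoly := X (0, s) * X (1, t) - X (0, t) * X (1, s)

/-- The column blocks `{0, 1}` and `{2, 3}`. -/
def blk : Fin 4 → Fin 2 := ![0, 0, 1, 1]

/-- Variables of the ring in which the two Segre cones are parametrized. -/
abbrev SegreVar : Type := Fin 4 ⊕ (Fin 2 × Fin 2)

abbrev SegrePoly : Type := MvPolynomial SegreVar ℂ

/-- The column factor. -/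
def colVar (s : Fin 4) : SegrePoly := X (Sum.inl s)

/-- The row factor of a column block. -/
def rowVar (i b : Fin 2) : SegrePoly := X (Sum.inr (i, b))

/-- The parametrization of the locus where both `2 × 2` column blocks are singular. -/
def segre : GhostPoly →ₐ[ℂ] SegrePoly :=
  aeval fun p : Fin 2 × Fin 4 => colVar p.2 * rowVar p.1 (blk p.2)

@[simp] lemma segre_X (i : Fin 2) (s : Fin 4) :
    segre (X (i, s)) = colVar s * rowVar i (blk s) := by
  simp [segre]

/-- The exponent map of `segre`. -/
def segreExp (m : Fin 2 × Fin 4 →₀ ℕ) : SegreVar →₀ ℕ :=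
  Finsupp.equivFunOnFinite.symm (Sum.elim (fun s => m (0, s) + m (1, s))
    (fun p => if p.2 = 0 then m (p.1, 0) + m (p.1, 1) else m (p.1, 2) + m (p.1, 3)))

/-- The exponent of a normal form monomial over a given monomial. -/
def segreSect (n : SegreVar →₀ ℕ) : Fin 2 × Fin 4 →₀ ℕ :=
  Finsupp.equivFunOnFinite.symm fun p =>
    (![![min (n (.inl 0)) (n (.inr (0, 0))),
        n (.inr (0, 0)) - min (n (.inl 0)) (n (.inr (0, 0))),
        min (n (.inl 2)) (n (.inr (0, 1))),
        n (.inr (0, 1)) - min (n (.inl 2)) (n (.inr (0, 1)))],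
      ![n (.inl 0) - min (n (.inl 0)) (n (.inr (0, 0))),
        n (.inl 1) - (n (.inr (0, 0)) - min (n (.inl 0)) (n (.inr (0, 0)))),
        n (.inl 2) - min (n (.inl 2)) (n (.inr (0, 1))),
        n (.inl 3) - (n (.inr (0, 1)) - min (n (.inl 2)) (n (.inr (0, 1))))]] :
      Fin 2 → Fin 4 → ℕ) p.1 p.2

lemma segre_monomial (m : Fin 2 × Fin 4 →₀ ℕ) (c : ℂ) :
    segre (monomial m c) = monomial (segreExp m) c := by
  rw [segre, aeval_monomial, monomial_eq]
  simp only [Finsupp.prod_fintype, pow_zero, implies_true, Fintype.prod_prod_type,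
    Fintype.prod_sum_type, Fin.prod_univ_succ, Fin.prod_univ_zero, segreExp, colVar, rowVar, blk]
  simp [pow_add, mul_pow, algebraMap_eq]
  left
  ring

/-- Modulo a block minor, `X (0,1) * X (1,0)` may be exchanged for `X (0,0) * X (1,1)`, and
similarly in the second block. Exchanging as often as possible yields the monomial with the same row
and column degrees and the largest exponent in the corner; this is the normal form selected by
`segreSect`. -/
lemma minor_cong_monomial (m : Fin 2 × Fin 4 →₀ ℕ) :
    (monomial m (1 : ℂ) - monomial (segreSect (segreExp m)) 1 : GhostPoly) ∈
      Ideal.span {minor 0 1, minor 2 3} := by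
  have key : ∀ (s t : Fin 4) (k : ℕ), minor s t ∈ Ideal.span {minor 0 1, minor 2 3} →
      Ideal.Quotient.mk (Ideal.span {minor 0 1, minor 2 3})
        (X (0, t) * X (1, s) : GhostPoly) ^ k =
      Ideal.Quotient.mk (Ideal.span {minor 0 1, minor 2 3}) (X (0, s) * X (1, t)) ^ k := by
    intro s t k h
    congr 1
    rw [eq_comm, Ideal.Quotient.eq]
    exact h
  have k1 := fun k => key 0 1 k (Ideal.subset_span (by simp))
  have k2 := fun k => key 2 3 k (Ideal.subset_span (by simp))
  rw [← Ideal.Quotient.eq]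
  have h1 : min (m (0, 0) + m (1, 0)) (m (0, 0) + m (0, 1)) = m (0, 0) + min (m (1, 0)) (m (0, 1)) :=
    by omega
  have h2 : min (m (0, 2) + m (1, 2)) (m (0, 2) + m (0, 3)) = m (0, 2) + min (m (1, 2)) (m (0, 3)) :=
    by omega
  rw [monomial_eq, monomial_eq]
  simp only [Finsupp.prod_fintype, pow_zero, implies_true, Fintype.prod_prod_type,
    Fin.prod_univ_succ, Fin.prod_univ_zero, segreExp, segreSect]
  simp [h1, h2]
  -- `a` and `b` count the exchanges made in the two blocks.
  obtain ⟨a, ha⟩ : ∃ a, a = min (m (1, 0)) (m (0, 1)) := ⟨_, rfl⟩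
  obtain ⟨b, hb⟩ : ∃ b, b = min (m (1, 2)) (m (0, 3)) := ⟨_, rfl⟩
  rw [← ha, ← hb]
  obtain ⟨x, hx⟩ : ∃ x, m (1, 0) = a + x := ⟨m (1, 0) - a, by omega⟩
  obtain ⟨y, hy⟩ : ∃ y, m (0, 1) = a + y := ⟨m (0, 1) - a, by omega⟩
  obtain ⟨z, hz⟩ : ∃ z, m (1, 2) = b + z := ⟨m (1, 2) - b, by omega⟩
  obtain ⟨t, ht⟩ : ∃ t, m (0, 3) = b + t := ⟨m (0, 3) - b, by omega⟩
  have e1 : m (0, 0) + m (1, 0) - (m (0, 0) + a) = x := by omega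
  have e2 : m (0, 0) + m (0, 1) - (m (0, 0) + a) = y := by omega
  have e3 : m (0, 1) + m (1, 1) - y = m (1, 1) + a := by omega
  have e4 : m (0, 2) + m (1, 2) - (m (0, 2) + b) = z := by omega
  have e5 : m (0, 2) + m (0, 3) - (m (0, 2) + b) = t := by omega
  have e6 : m (0, 3) + m (1, 3) - t = m (1, 3) + b := by omega
  rw [e1, e2, e3, e4, e5, e6, hx, hy, hz, ht]
  have k1 := k1 a
  have k2 := k2 b
  simp only [map_mul, mul_pow] at k1 k2
  simp only [pow_add]
  generalize (Ideal.Quotient.mk (Ideal.span {minor 0 1, minor 2 3})) = f at *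
  linear_combination (f (X (0, 0)) ^ m (0, 0) * f (X (0, 1)) ^ y * f (X (0, 2)) ^ m (0, 2) *
    f (X (0, 3)) ^ t * f (X (1, 0)) ^ x * f (X (1, 1)) ^ m (1, 1) * f (X (1, 2)) ^ z *
    f (X (1, 3)) ^ m (1, 3)) * (k1 * (f (X (0, 3)) * f (X (1, 2))) ^ b +
      (f (X (0, 0)) * f (X (1, 1))) ^ a * k2)

/-- The kernel of the parametrization is generated by the two block minors. -/
lemma exists_of_segre_eq_zero {r : GhostPoly} (h : segre r = 0) :
    ∃ a b, r = minor 0 1 * a + minor 2 3 * b := by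
  -- `ρ` lifts a monomial to its normal form, so `ρ ∘ segre` is the identity modulo the two minors;
  -- injectivity of `segre` on the quotient follows.
  let ρ : SegrePoly →ₗ[ℂ] GhostPoly :=
    (basisMonomials SegreVar ℂ).constr ℂ fun n => monomial (segreSect n) (1 : ℂ)
  have hρ : ∀ n c, ρ (monomial n c) = monomial (segreSect n) c := by
    intro n c
    have : monomial n c = c • basisMonomials SegreVar ℂ n := by simp [smul_monomial]
    rw [this, map_smul, Module.Basis.constr_basis, smul_monomial, smul_eq_mul, mul_one]
  have key : ∀ r : GhostPoly, r - ρ (segre r) ∈ Ideal.span {minor 0 1, minor 2 3} := by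
    intro r
    induction r using MvPolynomial.induction_on' with
    | monomial m c =>
      rw [segre_monomial, hρ]
      have := Ideal.mul_mem_left _ (C c) (minor_cong_monomial m)
      simpa [mul_sub, C_mul_monomial] using this
    | add p q hp hq =>
      have := Ideal.add_mem _ hp hq
      simpa [map_add, add_sub_add_comm] using this
  have := key r
  rw [h, map_zero, sub_zero, Ideal.mem_span_pair] at this
  obtain ⟨a, b, hab⟩ := this
  exact ⟨a, b, by rw [← hab]; ring⟩

lemma minor_ne_zero {s t : Fin 4} (hst : s ≠ t) : minor s t ≠ 0 := by
  intro h
  have := congrArg (eval fun p : Fin 2 × Fin 4 =>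
    if p = (0, s) ∨ p = (1, t) then (1 : ℂ) else 0) h
  simp [minor, hst.symm] at this

/-- The two minors share no variable, so a common divisor has degree zero in every variable and is a
nonzero constant. -/
lemma isRelPrime_minor : IsRelPrime (minor 0 1) (minor 2 3) := by
  have hdeg : ∀ (s t r : Fin 4) (i : Fin 2), r ≠ s → r ≠ t → degreeOf (i, r) (minor s t) = 0 := by
    intro s t r i h1 h2
    have hX : ∀ j u, r ≠ u → degreeOf (i, r) (X (j, u) : GhostPoly) = 0 := by
      intro j u h
      rw [degreeOf_X]
      simp [h]
    have hm : ∀ j k u v, r ≠ u → r ≠ v →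
        degreeOf (i, r) (X (j, u) * X (k, v) : GhostPoly) = 0 := by
      intro j k u v h h'
      have := degreeOf_mul_le (i, r) (X (j, u) : GhostPoly) (X (k, v))
      rw [hX j u h, hX k v h'] at this
      omega
    have := degreeOf_sub_le (i, r) (X (0, s) * X (1, t) : GhostPoly) (X (0, t) * X (1, s))
    rw [hm _ _ _ _ h1 h2, hm _ _ _ _ h2 h1] at this
    unfold minor
    simpa using this
  have hd : ∀ (p q : GhostPoly) (v), q ≠ 0 → p ∣ q → degreeOf v q = 0 → degreeOf v p = 0 := by
    rintro p q v hq ⟨r, rfl⟩ h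
    rw [degreeOf_mul_eq (left_ne_zero_of_mul hq) (right_ne_zero_of_mul hq)] at h
    omega
  intro d h1 h2
  have h0 : ∀ v, degreeOf v d = 0 := by
    rintro ⟨i, r⟩
    by_cases hr : r = 0 ∨ r = 1
    · refine hd _ _ _ (minor_ne_zero (by decide)) h2 (hdeg _ _ _ _ ?_ ?_) <;>
        rcases hr with rfl | rfl <;> decide
    · push Not at hr
      exact hd _ _ _ (minor_ne_zero (by decide)) h1 (hdeg _ _ _ _ hr.1 hr.2)
  have hd0 : d ≠ 0 := by
    rintro rfl
    exact minor_ne_zero (s := 0) (t := 1) (by decide) (zero_dvd_iff.mp h1)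
  have ht : totalDegree d = 0 := by
    rw [totalDegree_eq_zero_iff]
    intro m hm x
    have := (degreeOf_le_iff (n := x) (d := 0) (f := d)).mp (h0 x).le m hm
    omega
  rw [totalDegree_eq_zero_iff_eq_C] at ht
  rw [ht] at hd0 ⊢
  refine IsUnit.map C (isUnit_iff_ne_zero.mpr fun h => hd0 (by rw [h, map_zero]))

lemma minor_syzygy {a b : GhostPoly} (h : minor 0 1 * a + minor 2 3 * b = 0) :
    ∃ c, a = minor 2 3 * c ∧ b = -(minor 0 1 * c) := by
  have hdvd : minor 2 3 ∣ minor 0 1 * a := ⟨-b, by linear_combination h⟩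
  obtain ⟨c, rfl⟩ := isRelPrime_minor.symm.dvd_of_dvd_mul_left hdvd
  refine ⟨c, rfl, ?_⟩
  apply mul_left_cancel₀ (minor_ne_zero (s := 2) (t := 3) (by decide))
  linear_combination h

end

/-! ### Syzygies of variables and the weight grading -/

section

open MvPolynomial

section Syzygies

variable {σ : Type*} {i j k l : σ}

/-- Membership in an ideal generated by variables is decided monomial by monomial, and multiplying
by a variable outside the set cannot create it. This is the regularity of the variables, from which
the syzygies below follow by induction on their number. -/
lemma mem_span_X_of_X_mul_mem {s : Set σ} {a : MvPolynomial σ ℂ} (hk : k ∉ s)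
    (h : X k * a ∈ Ideal.span (X '' s : Set (MvPolynomial σ ℂ))) :
    a ∈ Ideal.span (X '' s : Set (MvPolynomial σ ℂ)) := by
  classical
  rw [mem_ideal_span_X_image] at h ⊢
  intro m hm
  obtain ⟨i, hi, him⟩ := h (Finsupp.single k 1 + m) (by
    rw [mem_support_iff, coeff_X_mul]
    exact mem_support_iff.mp hm)
  refine ⟨i, hi, ?_⟩
  have : k ≠ i := fun h => hk (h ▸ hi)
  simpa [Finsupp.single_apply, this] using him

lemma syzygy_two {a b : MvPolynomial σ ℂ} (hij : i ≠ j) (h : X i * a + X j * b = 0) :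
    ∃ c, a = X j * c ∧ b = -(X i * c) := by
  have h1 : a ∈ Ideal.span (X '' {j} : Set (MvPolynomial σ ℂ)) := by
    refine mem_span_X_of_X_mul_mem (k := i) (by simpa using hij) ?_
    rw [Set.image_singleton, Ideal.mem_span_singleton]
    exact ⟨-b, by linear_combination h⟩
  rw [Set.image_singleton, Ideal.mem_span_singleton] at h1
  obtain ⟨c, rfl⟩ := h1
  refine ⟨c, rfl, mul_left_cancel₀ (X_ne_zero j) ?_⟩
  linear_combination h

lemma exists_of_X_mul_eq_pair {a b c : MvPolynomial σ ℂ} (hi : k ≠ i) (hj : k ≠ j)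
    (h : X k * a = X i * b + X j * c) : ∃ b' c', a = X i * b' + X j * c' := by
  have h1 : a ∈ Ideal.span (X '' {i, j} : Set (MvPolynomial σ ℂ)) := by
    refine mem_span_X_of_X_mul_mem (k := k) (by simp [hi, hj]) ?_
    rw [Set.image_pair, Ideal.mem_span_pair]
    exact ⟨b, c, by rw [h]; ring⟩
  rw [Set.image_pair, Ideal.mem_span_pair] at h1
  obtain ⟨b', c', h'⟩ := h1
  exact ⟨b', c', by rw [← h']; ring⟩

lemma syzygy_three {a b c : MvPolynomial σ ℂ} (hij : i ≠ j) (hik : i ≠ k) (hjk : j ≠ k)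
    (h : X i * a + X j * b + X k * c = 0) :
    ∃ p q r, a = X j * p + X k * q ∧ b = -(X i * p) + X k * r ∧ c = -(X i * q) - X j * r := by
  obtain ⟨q, r, rfl⟩ := exists_of_X_mul_eq_pair (k := k) (i := i) (j := j) (a := c) (b := -a)
    (c := -b) hik.symm hjk.symm (by linear_combination h)
  obtain ⟨p, hp, hp'⟩ := syzygy_two hij (a := a + X k * q) (b := b + X k * r)
    (by linear_combination h)
  exact ⟨p, -q, -r, by linear_combination hp, by linear_combination hp', by ring⟩

lemma syzygy_four {a b c d : MvPolynomial σ ℂ} (hij : i ≠ j) (hik : i ≠ k) (hil : i ≠ l)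
    (hjk : j ≠ k) (hjl : j ≠ l) (hkl : k ≠ l)
    (h : X i * a + X j * b + X k * c + X l * d = 0) :
    ∃ p q r s t u, a = X j * p + X k * q + X l * r ∧ b = -(X i * p) + X k * s + X l * t ∧
      c = -(X i * q) - X j * s + X l * u ∧ d = -(X i * r) - X j * t - X k * u := by
  have h1 : d ∈ Ideal.span (X '' {i, j, k} : Set (MvPolynomial σ ℂ)) := by
    refine mem_span_X_of_X_mul_mem (k := l) (by simp [hil.symm, hjl.symm, hkl.symm]) ?_
    rw [Set.image_insert_eq, Set.image_pair, Ideal.mem_span_insert]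
    refine ⟨-a, X j * (-b) + X k * (-c), Ideal.mem_span_pair.mpr ⟨-b, -c, by ring⟩, ?_⟩
    linear_combination h
  rw [Set.image_insert_eq, Set.image_pair, Ideal.mem_span_insert] at h1
  obtain ⟨r, z, hz, rfl⟩ := h1
  obtain ⟨t, u, rfl⟩ := Ideal.mem_span_pair.mp hz
  obtain ⟨p, q, s, h1, h2, h3⟩ := syzygy_three hij hik hjk (a := a + X l * r) (b := b + X l * t)
    (c := c + X l * u) (by linear_combination h)
  exact ⟨p, q, -r, s, -t, -u, by linear_combination h1, by linear_combination h2,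
    by linear_combination h3, by ring⟩

end Syzygies

/-- Column degree minus row degree, for each of the two column blocks. -/
def segreWt : SegreVar → ℤ × ℤ :=
  Sum.elim (fun s => if blk s = 0 then (1, 0) else (0, 1))
    (fun p => if p.2 = 0 then (-1, 0) else (0, -1))

/-- The component of weight `n`. -/
def wtComp (n : ℤ × ℤ) : SegrePoly →ₗ[ℂ] SegrePoly := weightedHomogeneousComponent segreWt n

lemma coeff_wtComp (n : ℤ × ℤ) (p : SegrePoly) (d : SegreVar →₀ ℕ) :
    coeff d (wtComp n p) = if Finsupp.weight segreWt d = n then coeff d p else 0 :=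
  coeff_weightedHomogeneousComponent ..

lemma wtComp_monomial (n : ℤ × ℤ) (d : SegreVar →₀ ℕ) (c : ℂ) :
    wtComp n (monomial d c) = if Finsupp.weight segreWt d = n then monomial d c else 0 := by
  ext m
  rw [coeff_wtComp, coeff_monomial]
  by_cases h : d = m
  · subst h
    by_cases h' : Finsupp.weight segreWt d = n <;> simp [h']
  · by_cases h' : Finsupp.weight segreWt d = n <;> simp [h', coeff_monomial, h]

lemma wtComp_X_mul (n : ℤ × ℤ) (i : SegreVar) (p : SegrePoly) :
    wtComp n (X i * p) = X i * wtComp (n - segreWt i) p := by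
  ext d
  rw [coeff_wtComp, coeff_X_mul', coeff_X_mul', coeff_wtComp]
  by_cases h : i ∈ d.support
  · simp only [h, if_true]
    have hd : d = (d - Finsupp.single i 1) + Finsupp.single i 1 := by
      rw [tsub_add_cancel_of_le]
      rw [Finsupp.single_le_iff]
      exact Nat.one_le_iff_ne_zero.mpr (by simpa using h)
    have : Finsupp.weight segreWt d =
        Finsupp.weight segreWt (d - Finsupp.single i 1) + segreWt i := by
      conv_lhs => rw [hd]
      rw [map_add, Finsupp.weight_single]
      simp
    simp only [this, eq_sub_iff_add_eq]
  · simp [h]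

lemma wtComp_colVar_mul (n : ℤ × ℤ) (s : Fin 4) (p : SegrePoly) :
    wtComp n (colVar s * p) = colVar s * wtComp (n - segreWt (Sum.inl s)) p :=
  wtComp_X_mul ..

/-- Each generator maps to a column variable times a row variable of the same block, whose weights
cancel. -/
lemma wtComp_zero_segre (r : GhostPoly) : wtComp 0 (segre r) = segre r := by
  induction r using MvPolynomial.induction_on with
  | C a =>
    have : segre (C a) = monomial 0 a := by
      rw [← algebraMap_eq, AlgHom.commutes]
      rfl
    rw [this, wtComp_monomial]
    simp
  | add p q hp hq => rw [map_add, map_add, hp, hq]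
  | mul_X p v hp =>
    obtain ⟨i, s⟩ := v
    have : segre (p * X (i, s)) = X (Sum.inl s) * (X (Sum.inr (i, blk s)) * segre p) := by
      rw [map_mul, segre_X, colVar, rowVar]
      ring
    rw [this, wtComp_X_mul, wtComp_X_mul]
    have h0 : (0 - segreWt (Sum.inl s) - segreWt (Sum.inr (i, blk s)) : ℤ × ℤ) = 0 := by
      fin_cases s <;> simp [segreWt, blk]
    rw [h0, hp]

lemma weight_segreWt (d : SegreVar →₀ ℕ) : Finsupp.weight segreWt d =
    ((d (.inl 0) + d (.inl 1) : ℤ) - d (.inr (0, 0)) - d (.inr (1, 0)),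
      (d (.inl 2) + d (.inl 3) : ℤ) - d (.inr (0, 1)) - d (.inr (1, 1))) := by
  rw [Finsupp.weight_apply, Finsupp.sum_fintype _ _ (by simp)]
  ext <;> simp [Fintype.sum_sum_type, Fintype.sum_prod_type, Fin.sum_univ_succ, segreWt, blk] <;>
    ring

lemma wtComp_induction {n : ℤ × ℤ} {P : SegrePoly → Prop} (hadd : ∀ p q, P p → P q → P (p + q))
    (h0 : P 0) (h : ∀ d c, Finsupp.weight segreWt d = n → P (monomial d c)) (p : SegrePoly) :
    P (wtComp n p) := by
  induction p using MvPolynomial.induction_on' with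
  | monomial d c =>
    rw [wtComp_monomial]
    split_ifs with hd
    · exact h d c hd
    · exact h0
  | add p q hp hq =>
    rw [map_add]
    exact hadd _ _ hp hq

/-- Weight zero says that in each block the row degrees and the column degrees have equal sums.
These are the margins of a `2 × 2` table of exponents, which `segreSect` fills in; hence the image
of `segre` is the whole weight-zero part. -/
lemma exists_segre_eq_wtComp_zero (p : SegrePoly) : ∃ r, wtComp 0 p = segre r := by
  refine wtComp_induction (P := fun q => ∃ r, q = segre r) ?_ ⟨0, by simp⟩ ?_ p
  · rintro _ _ ⟨a, rfl⟩ ⟨b, rfl⟩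
    exact ⟨a + b, by simp⟩
  · intro d c hd
    rw [weight_segreWt, Prod.mk_eq_zero] at hd
    obtain ⟨h1, h2⟩ := hd
    have : segreExp (segreSect d) = d := by
      ext v
      rcases v with s | ⟨i, b⟩
      · fin_cases s <;> simp [segreExp, segreSect] <;> omega
      · fin_cases i <;> fin_cases b <;> simp [segreExp, segreSect] <;> omega
    exact ⟨monomial (segreSect d) c, by rw [segre_monomial, this]⟩

/-- A component of negative weight is divisible by the row variables. -/
lemma exists_wtComp_eq_sum_rowVar {n : ℤ × ℤ} (b : Fin 2)
    (hn : (if b = 0 then n.1 else n.2) < 0) (p : SegrePoly) :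
    ∃ q : Fin 2 → SegrePoly,
      wtComp n p = ∑ a, rowVar a b * wtComp (n - segreWt (Sum.inr (0, b))) (q a) := by
  refine wtComp_induction (P := fun p => ∃ q : Fin 2 → SegrePoly,
      p = ∑ a, rowVar a b * wtComp (n - segreWt (Sum.inr (0, b))) (q a)) ?_ ⟨0, by simp⟩ ?_ p
  · rintro _ _ ⟨q, rfl⟩ ⟨q', rfl⟩
    exact ⟨q + q', by simp [mul_add, Finset.sum_add_distrib]⟩
  · intro d c hd
    have hw : ∀ a, segreWt (Sum.inr (a, b)) = segreWt (Sum.inr (0, b)) := fun a => rfl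
    -- Without a row variable of block `b`, that component of the weight would be a sum of column
    -- degrees and could not be negative.
    obtain ⟨a, ha⟩ : ∃ a : Fin 2, d (.inr (a, b)) ≠ 0 := by
      by_contra! hcon
      rw [weight_segreWt] at hd
      have h1 := hcon 0
      have h2 := hcon 1
      rw [← hd] at hn
      fin_cases b <;> simp_all <;> omega
    refine ⟨Pi.single a (monomial (d - Finsupp.single (.inr (a, b)) 1) c), ?_⟩
    have hdd : d = Finsupp.single (.inr (a, b)) 1 + (d - Finsupp.single (.inr (a, b)) 1) := by
      rw [add_tsub_cancel_of_le]
      rw [Finsupp.single_le_iff]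
      exact Nat.one_le_iff_ne_zero.mpr ha
    have hm : monomial d c = rowVar a b * monomial (d - Finsupp.single (.inr (a, b)) 1) c := by
      conv_lhs => rw [hdd, ← one_mul c, ← monomial_mul]
      rfl
    have hd' : Finsupp.weight segreWt (d - Finsupp.single (.inr (a, b)) 1) =
        n - segreWt (Sum.inr (0, b)) := by
      rw [eq_sub_iff_add_eq, ← hw a, ← hd]
      conv_rhs => rw [hdd]
      rw [map_add, Finsupp.weight_single]
      simp [add_comm]
    rw [Finset.sum_eq_single a, Pi.single_eq_same, wtComp_monomial, if_pos hd', hm]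
    · intro a' _ ha'
      simp [ha']
    · simp

section Membership

variable {M : Type*} [AddCommGroup M] [Module SegrePoly M] {P : AddSubgroup M}

/-- `P` is stable only under the image of `segre`, not under all of `SegrePoly`, so only
coefficients of weight zero act on it directly. The next lemmas reduce negative weights to this case
by splitting off row variables. -/
lemma wtComp_zero_smul_mem (hP : ∀ r x, x ∈ P → segre r • x ∈ P) {x : M} (hx : x ∈ P)
    (c : SegrePoly) : wtComp 0 c • x ∈ P := by
  obtain ⟨r, hr⟩ := exists_segre_eq_wtComp_zero c
  rw [hr]
  exact hP r x hx

lemma wtComp_smul_mem_of_neg {n : ℤ × ℤ} (b : Fin 2) (hn : (if b = 0 then n.1 else n.2) < 0)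
    {x : M} (h : ∀ a c, wtComp (n - segreWt (Sum.inr (0, b))) c • rowVar a b • x ∈ P)
    (c : SegrePoly) : wtComp n c • x ∈ P := by
  obtain ⟨q, hq⟩ := exists_wtComp_eq_sum_rowVar b hn c
  rw [hq, Finset.sum_smul]
  refine P.sum_mem fun a _ => ?_
  rw [mul_comm, mul_smul]
  exact h a _

lemma wtComp_one_smul_mem (hP : ∀ r x, x ∈ P → segre r • x ∈ P) (b : Fin 2) {n : ℤ × ℤ}
    (hn : n = segreWt (Sum.inr (0, b))) {x : M}
    (hx : ∀ a, rowVar a b • x ∈ P) (c : SegrePoly) : wtComp n c • x ∈ P := by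
  refine wtComp_smul_mem_of_neg b ?_ (fun a c => ?_) c
  · rw [hn]
    fin_cases b <;> simp [segreWt]
  · rw [hn, sub_self]
    exact wtComp_zero_smul_mem hP (hx a) c

lemma wtComp_two_smul_mem (hP : ∀ r x, x ∈ P → segre r • x ∈ P) (b b' : Fin 2) {n : ℤ × ℤ}
    (hn : n = segreWt (Sum.inr (0, b)) + segreWt (Sum.inr (0, b'))) {x : M}
    (hx : ∀ a a', rowVar a b • rowVar a' b' • x ∈ P) (c : SegrePoly) : wtComp n c • x ∈ P := by
  refine wtComp_smul_mem_of_neg b' ?_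
    (fun a' c => wtComp_one_smul_mem hP b ?_ (fun a => hx a a') c) c
  · rw [hn]
    fin_cases b <;> fin_cases b' <;> simp [segreWt]
  · rw [hn]
    simp

end Membership

end

/-! ### Monomial cycle equations for the four mixed minors -/

section

open MvPolynomial

section Cone

variable {R M : Type*} [CommRing R] [AddCommGroup M] [Module R M]

/-- The Koszul differential after adjoining one generator `w` with `d w = f`; the pair `(x, y)`
stands for `x + w y`. -/
def cone (f : R) (d : M →ₗ[R] M) : M × M →ₗ[R] M × M :=
  ((d ∘ₗ LinearMap.fst R M M) + f • LinearMap.snd R M M).prod (-(d ∘ₗ LinearMap.snd R M M))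

@[simp] lemma cone_apply (f : R) (d : M →ₗ[R] M) (x : M × M) :
    cone f d x = (d x.1 + f • x.2, -d x.2) := rfl

end Cone

/-- The underlying module of the Koszul complex on four elements. -/
abbrev Kos4 (R : Type*) : Type _ :=
  (((R × R) × (R × R)) × ((R × R) × (R × R))) × (((R × R) × (R × R)) × ((R × R) × (R × R)))

/-- The Koszul differential on four elements. -/
def kos4 {R : Type*} [CommRing R] (f : Fin 4 → R) : Kos4 R →ₗ[R] Kos4 R :=
  cone (f 3) (cone (f 2) (cone (f 1) (cone (f 0) (0 : R →ₗ[R] R))))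

/-- The four minors with one column in each block. -/
def mixedMinor : Fin 4 → GhostPoly := ![minor 0 2, minor 0 3, minor 1 2, minor 1 3]

/-- The common factor of the mixed minors. -/
def segreDet : SegrePoly := rowVar 0 0 * rowVar 1 1 - rowVar 0 1 * rowVar 1 0

lemma segreDet_ne_zero : segreDet ≠ 0 := by
  intro h
  have := congrArg (eval fun v : SegreVar =>
    if v = .inr (0, 0) ∨ v = .inr (1, 1) then (1 : ℂ) else 0) h
  simp [segreDet, rowVar] at this

/-- The factor `segreDet` is the same for all four mixed minors. It cancels from the cycle
equations, leaving monomials in the column variables. -/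
lemma segre_minor_mixed (s t : Fin 4) (hs : blk s = 0) (ht : blk t = 1) :
    segre (minor s t) = segreDet * (colVar s * colVar t) := by
  simp only [minor, map_sub, map_mul, segre_X, hs, ht, segreDet]
  ring

lemma segre_minor_blk (s t : Fin 4) (h : blk s = blk t) : segre (minor s t) = 0 := by
  simp only [minor, map_sub, map_mul, segre_X, h]
  ring

/-- The element of degree one with the given coefficients. -/
def kosOne {R : Type*} [Zero R] (q : Fin 4 → R) : Kos4 R :=
  ((((0, q 0), (q 1, 0)), ((q 2, 0), (0, 0))), (((q 3, 0), (0, 0)), ((0, 0), (0, 0))))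

/-- The element of degree two with the given coefficients of
`w₁w₀, w₂w₀, w₂w₁, w₃w₀, w₃w₁, w₃w₂`. -/
def kosTwo {R : Type*} [Zero R] (q : Fin 6 → R) : Kos4 R :=
  ((((0, 0), (0, q 0)), ((0, q 1), (q 2, 0))), (((0, q 3), (q 4, 0)), ((q 5, 0), (0, 0))))

/-- The element of degree three with the given coefficients of
`w₂w₁w₀, w₃w₁w₀, w₃w₂w₀, w₃w₂w₁`. -/
def kosThree {R : Type*} [Zero R] (q : Fin 4 → R) : Kos4 R :=
  ((((0, 0), (0, 0)), ((0, 0), (0, q 0))), (((0, 0), (0, q 1)), ((0, q 2), (q 3, 0))))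

lemma colVar_ne_zero (s : Fin 4) : colVar s ≠ 0 := X_ne_zero _

lemma colVar_mul_eq {s t : Fin 4} (hst : s ≠ t) {a b : SegrePoly}
    (h : colVar s * a = colVar t * b) : ∃ c, a = colVar t * c ∧ b = colVar s * c := by
  obtain ⟨c, hc, hc'⟩ := syzygy_two (i := (Sum.inl s : SegreVar)) (j := Sum.inl t)
    (a := a) (b := -b) (by simpa using hst) (by simp only [colVar] at h; linear_combination h)
  exact ⟨c, hc, neg_injective hc'⟩

section Cycles

variable {P : AddSubgroup (Kos4 SegrePoly)} (hP : ∀ r x, x ∈ P → segre r • x ∈ P)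

include hP

/-- Grouping by `colVar 0` and `colVar 1` reduces the relation to syzygies of two variables. In the
resulting solution every coefficient has lost one column degree in one block, so it has weight `(-1,
0)` or `(0, -1)` and is divisible by row variables of that block; hence the row factors in the
hypotheses. -/
lemma kosOne_mem
    (h₁ : ∀ a, rowVar a 0 • kosOne ![colVar 1, 0, -colVar 0, 0] ∈ P)
    (h₂ : ∀ a, rowVar a 0 • kosOne ![0, colVar 1, 0, -colVar 0] ∈ P)
    (h₃ : ∀ a, rowVar a 1 • kosOne ![colVar 3, -colVar 2, 0, 0] ∈ P)
    (h₄ : ∀ a, rowVar a 1 • kosOne ![0, 0, colVar 3, -colVar 2] ∈ P)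
    {q : Fin 4 → SegrePoly} (hq : ∀ i, wtComp 0 (q i) = q i)
    (h : colVar 0 * colVar 2 * q 0 + colVar 0 * colVar 3 * q 1 + colVar 1 * colVar 2 * q 2 +
      colVar 1 * colVar 3 * q 3 = 0) : kosOne q ∈ P := by
  obtain ⟨g, hg, hg'⟩ := syzygy_two (i := (Sum.inl 0 : SegreVar)) (j := Sum.inl 1)
    (a := colVar 2 * q 0 + colVar 3 * q 1) (b := colVar 2 * q 2 + colVar 3 * q 3) (by simp)
    (by simp only [colVar] at *; linear_combination h)
  obtain ⟨c, d, rfl⟩ := exists_of_X_mul_eq_pair (k := (Sum.inl 1 : SegreVar)) (i := Sum.inl 2)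
    (j := Sum.inl 3) (by simp) (by simp) hg.symm
  obtain ⟨a, ha, ha'⟩ := syzygy_two (i := (Sum.inl 2 : SegreVar)) (j := Sum.inl 3)
    (a := q 0 - colVar 1 * c) (b := q 1 - colVar 1 * d) (by simp)
    (by simp only [colVar] at *; linear_combination hg)
  obtain ⟨b, hb, hb'⟩ := syzygy_two (i := (Sum.inl 2 : SegreVar)) (j := Sum.inl 3)
    (a := q 2 + colVar 0 * c) (b := q 3 + colVar 0 * d) (by simp)
    (by simp only [colVar] at *; linear_combination hg')
  have e0 : q 0 = colVar 1 * c + colVar 3 * a := by simp only [colVar] at *; linear_combination ha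
  have e1 : q 1 = colVar 1 * d - colVar 2 * a := by simp only [colVar] at *; linear_combination ha'
  have e2 : q 2 = -(colVar 0 * c) + colVar 3 * b := by
    simp only [colVar] at *; linear_combination hb
  have e3 : q 3 = -(colVar 0 * d) - colVar 2 * b := by
    simp only [colVar] at *; linear_combination hb'
  -- The entries of `q` have weight zero, so projecting the equations allows each coefficient to be
  -- replaced by its component of the complementary weight.
  replace e0 := congrArg (wtComp 0) e0
  replace e1 := congrArg (wtComp 0) e1
  replace e2 := congrArg (wtComp 0) e2
  replace e3 := congrArg (wtComp 0) e3
  simp only [hq, map_add, map_sub, map_neg, wtComp_colVar_mul] at e0 e1 e2 e3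
  have key : kosOne q =
      wtComp (-1, 0) c • kosOne ![colVar 1, 0, -colVar 0, 0] +
      wtComp (-1, 0) d • kosOne ![0, colVar 1, 0, -colVar 0] +
      wtComp (0, -1) a • kosOne ![colVar 3, -colVar 2, 0, 0] +
      wtComp (0, -1) b • kosOne ![0, 0, colVar 3, -colVar 2] := by
    simp [kosOne, e0, e1, e2, e3, segreWt, blk]
    (repeat' apply And.intro) <;> ring
  rw [key]
  refine P.add_mem (P.add_mem (P.add_mem ?_ ?_) ?_) ?_
  · exact wtComp_one_smul_mem hP 0 (by simp [segreWt]) h₁ c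
  · exact wtComp_one_smul_mem hP 0 (by simp [segreWt]) h₂ d
  · exact wtComp_one_smul_mem hP 1 (by simp [segreWt]) h₃ a
  · exact wtComp_one_smul_mem hP 1 (by simp [segreWt]) h₄ b

/-- The equations have a single solution up to a factor. Its entries contain one column variable of
each block, so the factor has weight `(-1, -1)` and supplies a row variable from each block. -/
lemma kosThree_mem
    (h₁ : ∀ a b, rowVar a 0 • rowVar b 1 • kosThree ![colVar 1 * colVar 3,
      -(colVar 1 * colVar 2), colVar 0 * colVar 3, -(colVar 0 * colVar 2)] ∈ P)
    {q : Fin 4 → SegrePoly} (hq : ∀ i, wtComp 0 (q i) = q i)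
    (h10 : colVar 1 * colVar 2 * q 0 + colVar 1 * colVar 3 * q 1 = 0)
    (h20 : -(colVar 0 * colVar 3 * q 0) + colVar 1 * colVar 3 * q 2 = 0)
    (h21 : colVar 0 * colVar 2 * q 0 + colVar 1 * colVar 3 * q 3 = 0) : kosThree q ∈ P := by
  obtain ⟨a, ha, ha'⟩ := colVar_mul_eq (s := 0) (t := 1) (a := q 0) (b := q 2) (by decide) (by
    apply mul_left_cancel₀ (colVar_ne_zero 3)
    linear_combination -h20)
  obtain ⟨b, hb, hb'⟩ := colVar_mul_eq (s := 2) (t := 3) (a := colVar 1 * a) (b := -q 1)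
    (by decide) (by
      apply mul_left_cancel₀ (colVar_ne_zero 1)
      rw [ha] at h10
      linear_combination h10)
  obtain ⟨c, rfl, rfl⟩ := colVar_mul_eq (s := 1) (t := 3) (by decide) hb
  have e0 : q 0 = colVar 1 * (colVar 3 * c) := ha
  have e1 : q 1 = -(colVar 1 * (colVar 2 * c)) := by linear_combination -hb'
  have e2 : q 2 = colVar 0 * (colVar 3 * c) := ha'
  have e3 : q 3 = -(colVar 0 * (colVar 2 * c)) := by
    apply mul_left_cancel₀ (mul_ne_zero (colVar_ne_zero 1) (colVar_ne_zero 3))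
    rw [e0] at h21
    linear_combination h21
  replace e0 := congrArg (wtComp 0) e0
  replace e1 := congrArg (wtComp 0) e1
  replace e2 := congrArg (wtComp 0) e2
  replace e3 := congrArg (wtComp 0) e3
  simp only [hq, map_neg, wtComp_colVar_mul] at e0 e1 e2 e3
  have key : kosThree q = wtComp (-1, -1) c • kosThree ![colVar 1 * colVar 3,
      -(colVar 1 * colVar 2), colVar 0 * colVar 3, -(colVar 0 * colVar 2)] := by
    simp [kosThree, e0, e1, e2, e3, segreWt, blk]
    (repeat' apply And.intro) <;> ring
  rw [key]
  exact wtComp_two_smul_mem hP 0 1 (by simp [segreWt]) h₁ c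

/-- Coprimality of the column variables gives `q 0`, `q 1`, `q 4`, `q 5` as single variables times
unknowns `a`, `b`, `c`, `d`, and then `q 2` and `q 3`. What remains is one linear relation with the
four column variables as coefficients. Its six Koszul solutions are the six families of hypotheses,
with two row variables for the two column degrees lost. -/
lemma kosTwo_mem
    (h₁ : ∀ a b, rowVar a 0 • rowVar b 0 • kosTwo ![colVar 1 * colVar 1, 0, colVar 0 * colVar 1,
      -(colVar 0 * colVar 1), 0, colVar 0 * colVar 0] ∈ P)
    (h₂ : ∀ a b, rowVar a 0 • rowVar b 1 • kosTwo ![colVar 1 * colVar 2, -(colVar 0 * colVar 3),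
      colVar 0 * colVar 2, 0, 0, 0] ∈ P)
    (h₃ : ∀ a b, rowVar a 0 • rowVar b 1 • kosTwo ![colVar 1 * colVar 3, 0, 0,
      -(colVar 0 * colVar 3), colVar 0 * colVar 2, 0] ∈ P)
    (h₄ : ∀ a b, rowVar a 0 • rowVar b 1 • kosTwo ![0, colVar 1 * colVar 3, 0,
      -(colVar 1 * colVar 2), 0, colVar 0 * colVar 2] ∈ P)
    (h₅ : ∀ a b, rowVar a 0 • rowVar b 1 • kosTwo ![0, 0, colVar 1 * colVar 3, 0,
      -(colVar 1 * colVar 2), colVar 0 * colVar 3] ∈ P)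
    (h₆ : ∀ a b, rowVar a 1 • rowVar b 1 • kosTwo ![0, colVar 3 * colVar 3,
      -(colVar 2 * colVar 3), -(colVar 2 * colVar 3), colVar 2 * colVar 2, 0] ∈ P)
    {q : Fin 6 → SegrePoly} (hq : ∀ i, wtComp 0 (q i) = q i)
    (k0 : colVar 0 * colVar 3 * q 0 + colVar 1 * colVar 2 * q 1 + colVar 1 * colVar 3 * q 3 = 0)
    (k1 : -(colVar 0 * colVar 2 * q 0) + colVar 1 * colVar 2 * q 2 + colVar 1 * colVar 3 * q 4 = 0)
    (k2 : -(colVar 0 * colVar 2 * q 1) - colVar 0 * colVar 3 * q 2 + colVar 1 * colVar 3 * q 5 = 0) :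
    kosTwo q ∈ P := by
  obtain ⟨g, hg, -⟩ := colVar_mul_eq (s := 0) (t := 1) (a := colVar 2 * q 0)
    (b := colVar 2 * q 2 + colVar 3 * q 4) (by decide) (by linear_combination -k1)
  obtain ⟨a, ha, -⟩ := colVar_mul_eq (s := 2) (t := 1) (by decide) hg
  obtain ⟨g, hg, -⟩ := colVar_mul_eq (s := 1) (t := 0) (a := colVar 3 * q 5)
    (b := colVar 2 * q 1 + colVar 3 * q 2) (by decide) (by linear_combination k2)
  obtain ⟨d, hd, -⟩ := colVar_mul_eq (s := 3) (t := 0) (by decide) hg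
  obtain ⟨g, hg, -⟩ := colVar_mul_eq (s := 2) (t := 3) (a := colVar 1 * q 1)
    (b := -(colVar 0 * q 0) - colVar 1 * q 3) (by decide) (by linear_combination k0)
  obtain ⟨b, hb, -⟩ := colVar_mul_eq (s := 1) (t := 3) (by decide) hg
  obtain ⟨g, hg, -⟩ := colVar_mul_eq (s := 3) (t := 2) (a := colVar 1 * q 4)
    (b := colVar 0 * q 0 - colVar 1 * q 2) (by decide) (by linear_combination k1)
  obtain ⟨c, hc, -⟩ := colVar_mul_eq (s := 1) (t := 2) (by decide) hg
  have h3 : q 3 = -(colVar 0 * a) - colVar 2 * b := by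
    apply mul_left_cancel₀ (mul_ne_zero (colVar_ne_zero 1) (colVar_ne_zero 3))
    rw [ha, hb] at k0
    linear_combination k0
  have h2 : q 2 = colVar 0 * a - colVar 3 * c := by
    apply mul_left_cancel₀ (mul_ne_zero (colVar_ne_zero 1) (colVar_ne_zero 2))
    rw [ha, hc] at k1
    linear_combination k1
  -- The one condition left on the unknowns: a syzygy of the four column variables.
  have hs : colVar 0 * a + colVar 1 * (-d) + colVar 2 * b + colVar 3 * (-c) = 0 := by
    apply mul_left_cancel₀ (mul_ne_zero (colVar_ne_zero 0) (colVar_ne_zero 3))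
    rw [hb, h2, hd] at k2
    linear_combination -k2
  obtain ⟨c₁, c₂, c₃, c₄, c₅, c₆, s1, s2, s3, s4⟩ := syzygy_four (i := (Sum.inl 0 : SegreVar))
    (j := Sum.inl 1) (k := Sum.inl 2) (l := Sum.inl 3) (by simp) (by simp) (by simp) (by simp)
    (by simp) (by simp) hs
  change a = colVar 1 * c₁ + colVar 2 * c₂ + colVar 3 * c₃ at s1
  change -d = -(colVar 0 * c₁) + colVar 2 * c₄ + colVar 3 * c₅ at s2
  change b = -(colVar 0 * c₂) - colVar 1 * c₄ + colVar 3 * c₆ at s3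
  change -c = -(colVar 0 * c₃) - colVar 1 * c₅ - colVar 2 * c₆ at s4
  have e0 : q 0 = colVar 1 * (colVar 1 * c₁) + colVar 1 * (colVar 2 * c₂) +
    colVar 1 * (colVar 3 * c₃) := by linear_combination ha + colVar 1 * s1
  have e1 : q 1 = -(colVar 0 * (colVar 3 * c₂)) - colVar 1 * (colVar 3 * c₄) +
    colVar 3 * (colVar 3 * c₆) := by linear_combination hb + colVar 3 * s3
  have e2 : q 2 = colVar 0 * (colVar 1 * c₁) + colVar 0 * (colVar 2 * c₂) -
      colVar 1 * (colVar 3 * c₅) - colVar 2 * (colVar 3 * c₆) := by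
    linear_combination h2 + colVar 0 * s1 + colVar 3 * s4
  have e3 : q 3 = -(colVar 0 * (colVar 1 * c₁)) - colVar 0 * (colVar 3 * c₃) +
      colVar 1 * (colVar 2 * c₄) - colVar 2 * (colVar 3 * c₆) := by
    linear_combination h3 - colVar 0 * s1 - colVar 2 * s3
  have e4 : q 4 = colVar 0 * (colVar 2 * c₃) + colVar 1 * (colVar 2 * c₅) +
    colVar 2 * (colVar 2 * c₆) := by linear_combination hc - colVar 2 * s4
  have e5 : q 5 = colVar 0 * (colVar 0 * c₁) - colVar 0 * (colVar 2 * c₄) -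
    colVar 0 * (colVar 3 * c₅) := by linear_combination hd - colVar 0 * s2
  replace e0 := congrArg (wtComp 0) e0
  replace e1 := congrArg (wtComp 0) e1
  replace e2 := congrArg (wtComp 0) e2
  replace e3 := congrArg (wtComp 0) e3
  replace e4 := congrArg (wtComp 0) e4
  replace e5 := congrArg (wtComp 0) e5
  simp only [hq, map_add, map_sub, map_neg, wtComp_colVar_mul] at e0 e1 e2 e3 e4 e5
  have key : kosTwo q =
      wtComp (-2, 0) c₁ • kosTwo ![colVar 1 * colVar 1, 0, colVar 0 * colVar 1,
        -(colVar 0 * colVar 1), 0, colVar 0 * colVar 0] +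
      wtComp (-1, -1) c₂ • kosTwo ![colVar 1 * colVar 2, -(colVar 0 * colVar 3),
        colVar 0 * colVar 2, 0, 0, 0] +
      wtComp (-1, -1) c₃ • kosTwo ![colVar 1 * colVar 3, 0, 0,
        -(colVar 0 * colVar 3), colVar 0 * colVar 2, 0] +
      wtComp (-1, -1) (-c₄) • kosTwo ![0, colVar 1 * colVar 3, 0,
        -(colVar 1 * colVar 2), 0, colVar 0 * colVar 2] +
      wtComp (-1, -1) (-c₅) • kosTwo ![0, 0, colVar 1 * colVar 3, 0,
        -(colVar 1 * colVar 2), colVar 0 * colVar 3] +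
      wtComp (0, -2) c₆ • kosTwo ![0, colVar 3 * colVar 3,
        -(colVar 2 * colVar 3), -(colVar 2 * colVar 3), colVar 2 * colVar 2, 0] := by
    simp [kosTwo, e0, e1, e2, e3, e4, e5, segreWt, blk]
    (repeat' apply And.intro) <;> ring
  rw [key]
  refine P.add_mem (P.add_mem (P.add_mem (P.add_mem (P.add_mem ?_ ?_) ?_) ?_) ?_) ?_
  · exact wtComp_two_smul_mem hP 0 0 (by simp [segreWt]) h₁ _
  · exact wtComp_two_smul_mem hP 0 1 (by simp [segreWt]) h₂ _
  · exact wtComp_two_smul_mem hP 0 1 (by simp [segreWt]) h₃ _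
  · exact wtComp_two_smul_mem hP 0 1 (by simp [segreWt]) h₄ _
  · exact wtComp_two_smul_mem hP 0 1 (by simp [segreWt]) h₅ _
  · exact wtComp_two_smul_mem hP 1 1 (by simp [segreWt]) h₆ _

end Cycles

end

/-! ### Leading parts of cycles modulo the block minors -/

section

open MvPolynomial

/-- The element of degree four with the given coefficient of `w₃w₂w₁w₀`. -/
def kosFour {R : Type*} [Zero R] (q : R) : Kos4 R :=
  ((((0, 0), (0, 0)), ((0, 0), (0, 0))), (((0, 0), (0, 0)), ((0, 0), (0, q))))

/-- The element of degree zero with the given coefficient. -/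
def kosZero {R : Type*} [Zero R] (q : R) : Kos4 R :=
  ((((q, 0), (0, 0)), ((0, 0), (0, 0))), (((0, 0), (0, 0)), ((0, 0), (0, 0))))

lemma kos4_add {R : Type*} [CommRing R] (f g : Fin 4 → R) (x : Kos4 R) :
    kos4 (f + g) x = kos4 f x + kos4 g x := by
  simp only [kos4, cone_apply, LinearMap.zero_apply, Pi.add_apply, Prod.smul_def, Prod.neg_mk,
    Prod.add_def, smul_eq_mul, Prod.mk.injEq]
  (repeat' apply And.intro) <;> ring

/-- The products of an entry of row `a` in the first column block and an entry of row `b` in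
the second one. -/
def blockProd (a b : Fin 2) : Fin 4 → GhostPoly :=
  ![X (a, 0) * X (b, 2), X (a, 0) * X (b, 3), X (a, 1) * X (b, 2), X (a, 1) * X (b, 3)]

lemma blockProd_sub_swap : blockProd 0 1 - blockProd 1 0 = mixedMinor := by
  ext1 k
  fin_cases k <;> simp [blockProd, mixedMinor, minor] <;> ring

/-- The extension of `segre` to the Koszul complex. -/
def segre4 : Kos4 GhostPoly →+ Kos4 SegrePoly :=
  let f : GhostPoly →+ SegrePoly := segre
  let f1 := f.prodMap f
  let f2 := f1.prodMap f1
  let f3 := f2.prodMap f2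
  f3.prodMap f3

lemma segre4_apply (x : Kos4 GhostPoly) : segre4 x =
  ((((segre x.1.1.1.1, segre x.1.1.1.2), (segre x.1.1.2.1, segre x.1.1.2.2)),
    ((segre x.1.2.1.1, segre x.1.2.1.2), (segre x.1.2.2.1, segre x.1.2.2.2))),
   (((segre x.2.1.1.1, segre x.2.1.1.2), (segre x.2.1.2.1, segre x.2.1.2.2)),
    ((segre x.2.2.1.1, segre x.2.2.1.2), (segre x.2.2.2.1, segre x.2.2.2.2)))) := rfl

lemma segre4_smul (r : GhostPoly) (x : Kos4 GhostPoly) : segre4 (r • x) = segre r • segre4 x := by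
  simp only [segre4_apply, Prod.smul_fst, Prod.smul_snd, smul_eq_mul, map_mul, Prod.smul_mk]

section

variable {P : Submodule GhostPoly (Kos4 GhostPoly)}
  (hd : ∀ x, kos4 mixedMinor x ∈ P)

include hd

/-- The antisymmetric part of `blockProd` in its two rows is zero or plus or minus `mixedMinor`, so
it contributes only boundaries. Since `2` is invertible, the symmetric combinations suffice. -/
lemma kos4_blockProd_mem {y : Kos4 GhostPoly}
    (h : ∀ a b, kos4 (blockProd a b + blockProd b a) y ∈ P) (a b : Fin 2) :
    kos4 (blockProd a b) y ∈ P := by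
  have hsub : ∀ f g : Fin 4 → GhostPoly, kos4 (f - g) y = kos4 f y - kos4 g y := fun f g => by
    rw [eq_sub_iff_add_eq, ← kos4_add, sub_add_cancel]
  have hs : kos4 (blockProd a b) y - kos4 (blockProd b a) y ∈ P := by
    have h01 := hd y
    rw [← blockProd_sub_swap, hsub] at h01
    fin_cases a <;> fin_cases b
    · simp
    · exact h01
    · simpa using P.neg_mem h01
    · simp
  have := P.smul_mem (C (1 / 2)) (P.add_mem (h a b) hs)
  rw [kos4_add] at this
  have h2 : kos4 (blockProd a b) y + kos4 (blockProd b a) y +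
      (kos4 (blockProd a b) y - kos4 (blockProd b a) y) = (C 2 : GhostPoly) • kos4 (blockProd a b) y := by
    rw [show (C 2 : GhostPoly) = 2 from map_ofNat C 2]
    module
  rw [h2, smul_smul, ← C_mul] at this
  simpa using this

/-- The reduced cycle equations separate by exterior degree. The hypotheses list the leading parts
that generate the solutions in degrees zero to three, and degree four has no nonzero solution. The
conclusion is an equality only after `segre4`, that is, modulo the block minors. -/
lemma exists_segre4_eq
    (h0 : kosZero 1 ∈ P)
    (h11 : ∀ a, kosOne ![X (a, 1), 0, -X (a, 0), 0] ∈ P)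
    (h12 : ∀ a, kosOne ![0, X (a, 1), 0, -X (a, 0)] ∈ P)
    (h13 : ∀ a, kosOne ![X (a, 3), -X (a, 2), 0, 0] ∈ P)
    (h14 : ∀ a, kosOne ![0, 0, X (a, 3), -X (a, 2)] ∈ P)
    (h21 : ∀ a b, kosTwo ![2 * (X (a, 1) * X (b, 1)), 0, X (a, 0) * X (b, 1) + X (b, 0) * X (a, 1),
      -(X (a, 0) * X (b, 1) + X (b, 0) * X (a, 1)), 0, 2 * (X (a, 0) * X (b, 0))] ∈ P)
    (h22 : ∀ a b, kosTwo ![0, 2 * (X (a, 3) * X (b, 3)),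
      -(X (a, 2) * X (b, 3) + X (b, 2) * X (a, 3)), -(X (a, 2) * X (b, 3) + X (b, 2) * X (a, 3)),
      2 * (X (a, 2) * X (b, 2)), 0] ∈ P)
    (h23 : ∀ a b k, kos4 (blockProd a b + blockProd b a) (kosThree (Pi.single k 1)) ∈ P)
    (h3 : ∀ a b, kos4 (blockProd a b + blockProd b a) (kosFour 1) ∈ P)
    {x : Kos4 GhostPoly} (hx : segre4 (kos4 mixedMinor x) = 0) :
    ∃ p ∈ P, segre4 p = segre4 x := by
  have h23' := fun k => kos4_blockProd_mem hd (fun a b => h23 a b k)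
  have h3' := kos4_blockProd_mem hd h3
  set P' := P.toAddSubgroup.map segre4 with hP'
  have hmem : ∀ y, y ∈ P' ↔ ∃ p ∈ P, segre4 p = y := fun y => Iff.rfl
  have hsm : ∀ r y, y ∈ P' → segre r • y ∈ P' := by
    rintro r y ⟨p, hp, rfl⟩
    exact ⟨r • p, P.smul_mem r hp, segre4_smul r p⟩
  rw [← hmem]
  obtain ⟨⟨⟨⟨q, q0⟩, ⟨q1, q10⟩⟩, ⟨⟨q2, q20⟩, ⟨q21, q210⟩⟩⟩,
    ⟨⟨⟨q3, q30⟩, ⟨q31, q310⟩⟩, ⟨⟨q32, q320⟩, ⟨q321, q3210⟩⟩⟩⟩ := x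
  have hf0 : segre (mixedMinor 0) = segreDet * (colVar 0 * colVar 2) :=
    segre_minor_mixed 0 2 rfl rfl
  have hf1 : segre (mixedMinor 1) = segreDet * (colVar 0 * colVar 3) :=
    segre_minor_mixed 0 3 rfl rfl
  have hf2 : segre (mixedMinor 2) = segreDet * (colVar 1 * colVar 2) :=
    segre_minor_mixed 1 2 rfl rfl
  have hf3 : segre (mixedMinor 3) = segreDet * (colVar 1 * colVar 3) :=
    segre_minor_mixed 1 3 rfl rfl
  -- Splits the equation into components and kills the degree-four coefficient, which is multiplied
  -- by nonzero elements of a domain. In degrees two and three, three of the scalar equations are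
  -- enough.
  simp [segre4_apply, kos4, hf0, hf1, hf2, hf3, segreDet_ne_zero, colVar_ne_zero] at hx
  obtain ⟨⟨⟨⟨e1, k0⟩, k1, h10⟩, ⟨k2, h20⟩, h21', hq4⟩, -⟩ := hx
  have key : segre4 ((((q, q0), (q1, q10)), ((q2, q20), (q21, q210))),
      (((q3, q30), (q31, q310)), ((q32, q320), (q321, q3210)))) =
      segre q • segre4 (kosZero 1) + kosOne ![segre q0, segre q1, segre q2, segre q3] +
      kosTwo ![segre q10, segre q20, segre q21, segre q30, segre q31, segre q32] +
      kosThree ![segre q210, segre q310, segre q320, segre q321] := by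
    simp [segre4_apply, kosZero, kosOne, kosTwo, kosThree, hq4]
  rw [key]
  have himg : ∀ {y z}, y ∈ P → segre4 y = z → z ∈ P' := fun h h' => ⟨_, h, h'⟩
  -- In the symmetrized generators taken within one block, the two summands have the same image
  -- under `segre`, which produces a factor `2`.
  have hhalf : ∀ {y z}, y ∈ P → segre4 y = (2 : SegrePoly) • z → z ∈ P' := by
    intro y z hy h
    refine himg (P.smul_mem (C (1 / 2)) hy) ?_
    rw [segre4_smul, h, smul_smul, ← algebraMap_eq, AlgHom.commutes, algebraMap_eq,
      show (2 : SegrePoly) = C 2 from (map_ofNat C 2).symm, ← C_mul]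
    simp
  refine P'.add_mem (P'.add_mem (P'.add_mem ?_ ?_) ?_) ?_
  · exact hsm q _ ⟨_, h0, rfl⟩
  · refine kosOne_mem hsm (fun a => himg (h11 a) ?_) (fun a => himg (h12 a) ?_)
      (fun a => himg (h13 a) ?_) (fun a => himg (h14 a) ?_) ?_ ?_
    · simp [kosOne, segre4_apply, blk, mul_comm]
    · simp [kosOne, segre4_apply, blk, mul_comm]
    · simp [kosOne, segre4_apply, blk, mul_comm]
    · simp [kosOne, segre4_apply, blk, mul_comm]
    · intro i
      fin_cases i <;> exact wtComp_zero_segre _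
    · apply mul_left_cancel₀ segreDet_ne_zero
      simp [-mul_eq_zero]
      linear_combination e1
  · refine kosTwo_mem hsm (fun a b => hhalf (h21 a b) ?_)
      (fun a b => himg (h23' 0 a b) ?_) (fun a b => himg (h23' 1 a b) ?_)
      (fun a b => himg (h23' 2 a b) ?_) (fun a b => himg (h23' 3 a b) ?_)
      (fun a b => hhalf (h22 a b) ?_) ?_ ?_ ?_ ?_
    · simp [kosTwo, segre4_apply, blk, two_mul]
      (repeat' apply And.intro) <;> ring
    · simp [kosTwo, kosThree, kos4, blockProd, segre4_apply, blk]
      (repeat' apply And.intro) <;> ring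
    · simp [kosTwo, kosThree, kos4, blockProd, segre4_apply, blk]
      (repeat' apply And.intro) <;> ring
    · simp [kosTwo, kosThree, kos4, blockProd, segre4_apply, blk]
      (repeat' apply And.intro) <;> ring
    · simp [kosTwo, kosThree, kos4, blockProd, segre4_apply, blk]
      (repeat' apply And.intro) <;> ring
    · simp [kosTwo, segre4_apply, blk, two_mul]
      (repeat' apply And.intro) <;> ring
    · intro i
      fin_cases i <;> exact wtComp_zero_segre _
    · apply mul_left_cancel₀ segreDet_ne_zero
      simp [-mul_eq_zero]
      linear_combination k0
    · apply mul_left_cancel₀ segreDet_ne_zero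
      simp [-mul_eq_zero]
      linear_combination k1
    · apply mul_left_cancel₀ segreDet_ne_zero
      simp [-mul_eq_zero]
      linear_combination k2
  · refine kosThree_mem hsm (fun a b => himg (h3' a b) ?_) ?_ ?_ ?_ ?_
    · simp [kosThree, kosFour, kos4, blockProd, segre4_apply, blk]
      (repeat' apply And.intro) <;> ring
    · intro i
      fin_cases i <;> exact wtComp_zero_segre _
    · apply mul_left_cancel₀ segreDet_ne_zero
      simp [-mul_eq_zero]
      linear_combination h10
    · apply mul_left_cancel₀ segreDet_ne_zero
      simp [-mul_eq_zero]
      linear_combination h20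
    · apply mul_left_cancel₀ segreDet_ne_zero
      simp [-mul_eq_zero]
      linear_combination h21'

end

end

/-! ### Adjoining the two block minors -/

section

open MvPolynomial

section Exactness

variable {M N : Type*} [AddCommGroup M] [AddCommGroup N] [Module GhostPoly M]

/-- Elements killed by `f` are combinations of the two block minors. -/
def KernelMinor (f : M →+ N) : Prop :=
  ∀ x, f x = 0 → ∃ a b, x = minor 0 1 • a + minor 2 3 • b

lemma KernelMinor.prodMap {f : M →+ N} (h : KernelMinor f) : KernelMinor (f.prodMap f) := by
  rintro ⟨x, y⟩ hxy
  obtain ⟨a, b, rfl⟩ := h x (Prod.ext_iff.mp hxy).1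
  obtain ⟨c, d, rfl⟩ := h y (Prod.ext_iff.mp hxy).2
  exact ⟨(a, c), (b, d), rfl⟩

lemma kernelMinor_segre4 : KernelMinor segre4 :=
  KernelMinor.prodMap <| KernelMinor.prodMap <| KernelMinor.prodMap <| KernelMinor.prodMap
    fun _ => exists_of_segre_eq_zero

variable (M) in
/-- The two block minors form a regular sequence on `M`. -/
def RegularMinor : Prop :=
  ∀ a b : M, minor 0 1 • a + minor 2 3 • b = 0 → ∃ c, a = minor 2 3 • c ∧ b = -(minor 0 1 • c)

lemma RegularMinor.prod (h : RegularMinor M) : RegularMinor (M × M) := by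
  rintro ⟨a, a'⟩ ⟨b, b'⟩ hab
  obtain ⟨c, rfl, rfl⟩ := h a b (Prod.ext_iff.mp hab).1
  obtain ⟨d, rfl, rfl⟩ := h a' b' (Prod.ext_iff.mp hab).2
  exact ⟨(c, d), rfl, rfl⟩

lemma regularMinor_kos4 : RegularMinor (Kos4 GhostPoly) :=
  .prod <| .prod <| .prod <| .prod fun _ _ => minor_syzygy

end Exactness

instance {R : Type*} [CommRing R] : AddCommGroup (Kos4 R) := inferInstance

instance {R : Type*} [CommRing R] : Module R (Kos4 R) := inferInstance

instance {R : Type*} [CommRing R] [IsDomain R] : Module.IsTorsionFree R (Kos4 R) := inferInstance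

lemma segre4_minor_smul {s t : Fin 4} (h : blk s = blk t) (x : Kos4 GhostPoly) :
    segre4 (minor s t • x) = 0 := by
  rw [segre4_smul, segre_minor_blk s t h, zero_smul]

/-- Adjoining the two block minors kills the kernel of the reduction `f`. -/
lemma exists_cone_cone_eq {M N : Type*} [AddCommGroup M] [AddCommGroup N] [Module GhostPoly M]
    [Module.IsTorsionFree GhostPoly M] {f : M →+ N} (hf : KernelMinor f) (hM : RegularMinor M)
    {d : M →ₗ[GhostPoly] M} (hdd : ∀ z, d (d z) = 0) {x : (M × M) × (M × M)}
    (hx : cone (minor 2 3) (cone (minor 0 1) d) x = 0) (h : f x.1.1 = 0) :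
    ∃ y, x = cone (minor 2 3) (cone (minor 0 1) d) y := by
  obtain ⟨⟨x0, x1⟩, ⟨x2, x3⟩⟩ := x
  obtain ⟨a, b, rfl⟩ := hf _ h
  simp only [cone_apply, Prod.smul_mk, Prod.mk_add_mk, Prod.neg_mk, Prod.mk_eq_zero,
    map_add, map_smul] at hx
  obtain ⟨⟨h1, h2⟩, h3, h4⟩ := hx
  -- Subtracting the boundaries that come from `a` and `b` removes the leading part; what remains in
  -- the next two components is a syzygy of the two minors.
  obtain ⟨c, hc, hc'⟩ := hM (x1 + d a) (x2 + d b) (by rw [← h1]; module)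
  -- The last component is determined because multiplication by a minor is injective on `M`.
  have h5 : x3 = d c := by
    have h6 : minor 2 3 • (x3 - d c) = 0 := by
      have := congrArg d hc
      rw [map_add, hdd, add_zero, map_smul] at this
      rw [smul_sub, ← this, ← h2]
      abel
    rw [smul_eq_zero, or_iff_right (minor_ne_zero (by decide)), sub_eq_zero] at h6
    exact h6
  refine ⟨((0, a), (b, c)), ?_⟩
  have e1 : x1 = minor 2 3 • c - d a := by rw [← hc]; abel
  have e2 : x2 = -(minor 0 1 • c) - d b := by rw [← neg_eq_iff_eq_neg.mpr hc']; abel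
  rw [h5, e1, e2]
  simp only [cone_apply, Prod.smul_mk, Prod.mk_add_mk, Prod.neg_mk, map_zero, zero_add,
    neg_neg, Prod.mk.injEq, and_true, true_and]
  exact ⟨by abel, by abel⟩

/-- The difference of two cycles with the same reduced leading part has leading part in the ideal of
the two minors, so it is a boundary by regularity, and `L` contains the boundaries. -/
lemma mem_of_cone_cone_eq_zero {M N : Type*} [AddCommGroup M] [AddCommGroup N]
    [Module GhostPoly M] [Module.IsTorsionFree GhostPoly M] {f : M →+ N} (hf : KernelMinor f)
    (hM : RegularMinor M) {d : M →ₗ[GhostPoly] M} (hdd : ∀ z, d (d z) = 0)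
    {L : Submodule GhostPoly ((M × M) × (M × M))}
    (hd : ∀ x, cone (minor 2 3) (cone (minor 0 1) d) x ∈ L)
    (hL : ∀ x ∈ L, cone (minor 2 3) (cone (minor 0 1) d) x = 0)
    {x : (M × M) × (M × M)} (hx : cone (minor 2 3) (cone (minor 0 1) d) x = 0)
    (hy : ∃ y ∈ L, f y.1.1 = f x.1.1) : x ∈ L := by
  obtain ⟨y, hy, hyx⟩ := hy
  obtain ⟨z, hz⟩ := exists_cone_cone_eq hf hM hdd (x := x - y) (by rw [map_sub, hx, hL y hy, sub_zero])
    (by rw [Prod.fst_sub, Prod.fst_sub, map_sub, hyx, sub_self])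
  rw [← sub_add_cancel x y, hz]
  exact L.add_mem (hd z) hy

lemma cone_cone_self {R M : Type*} [CommRing R] [AddCommGroup M] [Module R M] (f : R)
    {d : M →ₗ[R] M} (hdd : ∀ z, d (d z) = 0) (x : M × M) : cone f d (cone f d x) = 0 := by
  simp only [cone_apply, map_add, map_smul, map_neg, hdd, Prod.mk_eq_zero]
  exact ⟨by module, by simp⟩

lemma kos4_kos4 {R : Type*} [CommRing R] (f : Fin 4 → R) (x : Kos4 R) :
    kos4 f (kos4 f x) = 0 :=
  cone_cone_self _ (cone_cone_self _ (cone_cone_self _ (cone_cone_self _ fun _ => rfl))) x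

/-- The Koszul differential for the six minors. -/
def kos6 : (Kos4 GhostPoly × Kos4 GhostPoly) × (Kos4 GhostPoly × Kos4 GhostPoly) →ₗ[GhostPoly]
    (Kos4 GhostPoly × Kos4 GhostPoly) × (Kos4 GhostPoly × Kos4 GhostPoly) :=
  cone (minor 2 3) (cone (minor 0 1) (kos4 mixedMinor))

/-- A module of cycles for the six minors which contains the boundaries and cycles with the listed
leading parts contains all cycles. -/
lemma mem_of_kos6_eq_zero
    {L : Submodule GhostPoly
      ((Kos4 GhostPoly × Kos4 GhostPoly) × (Kos4 GhostPoly × Kos4 GhostPoly))}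
    (hd : ∀ x, kos6 x ∈ L) (hL : ∀ x ∈ L, kos6 x = 0)
    {P : Submodule GhostPoly (Kos4 GhostPoly)} (hP : ∀ p, p ∈ P ↔ ∃ y ∈ L, y.1.1 = p)
    (h0 : kosZero 1 ∈ P)
    (h11 : ∀ a, kosOne ![X (a, 1), 0, -X (a, 0), 0] ∈ P)
    (h12 : ∀ a, kosOne ![0, X (a, 1), 0, -X (a, 0)] ∈ P)
    (h13 : ∀ a, kosOne ![X (a, 3), -X (a, 2), 0, 0] ∈ P)
    (h14 : ∀ a, kosOne ![0, 0, X (a, 3), -X (a, 2)] ∈ P)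
    (h21 : ∀ a b, kosTwo ![2 * (X (a, 1) * X (b, 1)), 0, X (a, 0) * X (b, 1) + X (b, 0) * X (a, 1),
      -(X (a, 0) * X (b, 1) + X (b, 0) * X (a, 1)), 0, 2 * (X (a, 0) * X (b, 0))] ∈ P)
    (h22 : ∀ a b, kosTwo ![0, 2 * (X (a, 3) * X (b, 3)),
      -(X (a, 2) * X (b, 3) + X (b, 2) * X (a, 3)), -(X (a, 2) * X (b, 3) + X (b, 2) * X (a, 3)),
      2 * (X (a, 2) * X (b, 2)), 0] ∈ P)
    (h23 : ∀ a b k, kos4 (blockProd a b + blockProd b a) (kosThree (Pi.single k 1)) ∈ P)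
    (h3 : ∀ a b, kos4 (blockProd a b + blockProd b a) (kosFour 1) ∈ P)
    {x} (hx : kos6 x = 0) : x ∈ L := by
  -- In the leading component of the cycle equation the block minors appear as coefficients and
  -- vanish under `segre`.
  have hx' : segre4 (kos4 mixedMinor x.1.1) = 0 := by
    have h1 : kos4 mixedMinor x.1.1 + minor 0 1 • x.1.2 + minor 2 3 • x.2.1 = 0 :=
      (Prod.ext_iff.mp (Prod.ext_iff.mp hx).1).1
    have h2 := congrArg segre4 h1
    rwa [map_add, map_add, segre4_minor_smul (s := 0) (t := 1) rfl,
      segre4_minor_smul (s := 2) (t := 3) rfl, add_zero, add_zero, map_zero] at h2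
  have hdP : ∀ z, kos4 mixedMinor z ∈ P := fun z =>
    (hP _).mpr ⟨kos6 ((z, 0), 0), hd _, by simp [kos6]⟩
  obtain ⟨p, hp, hpx⟩ := exists_segre4_eq hdP h0 h11 h12 h13 h14 h21 h22 h23 h3 hx'
  obtain ⟨y, hy, rfl⟩ := (hP p).mp hp
  exact mem_of_cone_cone_eq_zero kernelMinor_segre4 regularMinor_kos4 (kos4_kos4 mixedMinor) hd hL
    hx ⟨y, hy, hpx⟩

end

/-! ### The Koszul complex inside the exterior algebra -/

section

section Adjoin

variable {R M N : Type*} [CommRing R] [AddCommGroup M] [Module R M] [AddCommGroup N] [Module R N]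

/-- Extension of a parametrization by one more odd generator `w`: `(x, y) ↦ f x + w f y`. -/
def adjoinGen (w : ExteriorAlgebra R M) (f : N →ₗ[R] ExteriorAlgebra R M) :
    N × N →ₗ[R] ExteriorAlgebra R M :=
  f.coprod (LinearMap.mulLeft R w ∘ₗ f)

@[simp] lemma adjoinGen_apply (w : ExteriorAlgebra R M) (f : N →ₗ[R] ExteriorAlgebra R M)
    (x : N × N) : adjoinGen w f x = f x.1 + w * f x.2 := rfl

/-- Contraction of the exterior algebra with a linear form. -/
abbrev contract (ℓ : Module.Dual R M) : ExteriorAlgebra R M →ₗ[R] ExteriorAlgebra R M :=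
  CliffordAlgebra.contractLeft (Q := (0 : QuadraticForm R M)) ℓ

lemma contract_ι_mul (ℓ : Module.Dual R M) (v : M) (x : ExteriorAlgebra R M) :
    contract ℓ (ExteriorAlgebra.ι R v * x) = ℓ v • x - ExteriorAlgebra.ι R v * contract ℓ x :=
  CliffordAlgebra.contractLeft_ι_mul ..

lemma contract_adjoinGen {ℓ : Module.Dual R M} {v : M} {f : N →ₗ[R] ExteriorAlgebra R M}
    {d : N →ₗ[R] N} (h : ∀ x, contract ℓ (f x) = f (d x)) (x : N × N) :
    contract ℓ (adjoinGen (ExteriorAlgebra.ι R v) f x) =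
      adjoinGen (ExteriorAlgebra.ι R v) f (cone (ℓ v) d x) := by
  simp only [adjoinGen_apply, map_add, contract_ι_mul, h, cone_apply, map_smul, map_neg, mul_neg]
  abel

lemma contract_adjoinGen_eq_zero {ℓ : Module.Dual R M} {v : M} {f : N →ₗ[R] ExteriorAlgebra R M}
    (h : ∀ x, contract ℓ (f x) = 0) (hv : ℓ v = 0) (x : N × N) :
    contract ℓ (adjoinGen (ExteriorAlgebra.ι R v) f x) = 0 := by
  simp [contract_ι_mul, h, hv]

/-- Contraction with a form dual to the new generator and zero on the previous part reads off the
coefficient of that generator. -/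
lemma adjoinGen_injective {ℓ : Module.Dual R M} {v : M} {f : N →ₗ[R] ExteriorAlgebra R M}
    (hf : Function.Injective f) (h : ∀ x, contract ℓ (f x) = 0) (hv : ℓ v = 1) :
    Function.Injective (adjoinGen (ExteriorAlgebra.ι R v) f) := by
  rw [injective_iff_map_eq_zero] at hf ⊢
  intro x hx
  have h2 := congrArg (contract ℓ) hx
  simp only [adjoinGen_apply, map_add, contract_ι_mul, h, hv, one_smul, mul_zero, sub_zero,
    zero_add, map_zero] at h2
  have h2 := hf _ h2
  rw [adjoinGen_apply, h2, map_zero, mul_zero, add_zero] at hx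
  exact Prod.ext (hf _ hx) h2

/-- Left multiplication by `ι v` preserves the range of `f`. -/
def MulStable (f : N →ₗ[R] ExteriorAlgebra R M) (v : M) : Prop :=
  ∀ x ∈ LinearMap.range f, ExteriorAlgebra.ι R v * x ∈ LinearMap.range f

lemma mulStable_adjoinGen_self (f : N →ₗ[R] ExteriorAlgebra R M) (v : M) :
    MulStable (adjoinGen (ExteriorAlgebra.ι R v) f) v := by
  rintro _ ⟨x, rfl⟩
  refine ⟨(0, x.1), ?_⟩
  simp [mul_add, ← mul_assoc]

lemma MulStable.adjoinGen {f : N →ₗ[R] ExteriorAlgebra R M} {v : M} (h : MulStable f v) (u : M) :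
    MulStable (adjoinGen (ExteriorAlgebra.ι R u) f) v := by
  rintro _ ⟨x, rfl⟩
  obtain ⟨y, hy⟩ := h _ ⟨x.1, rfl⟩
  obtain ⟨z, hz⟩ := h _ ⟨x.2, rfl⟩
  refine ⟨(y, -z), ?_⟩
  have : ExteriorAlgebra.ι R v * ExteriorAlgebra.ι R u =
      -(ExteriorAlgebra.ι R u * ExteriorAlgebra.ι R v) :=
    eq_neg_of_add_eq_zero_left (ExteriorAlgebra.ι_add_mul_swap v u)
  simp [hy, hz, mul_add, ← mul_assoc, this]

/-- The exterior algebra is generated from `1` by left multiplication with vectors, and the vectors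
preserving the range form a submodule, so a spanning set is enough. -/
lemma surjective_of_mulStable {f : N →ₗ[R] ExteriorAlgebra R M} (h1 : 1 ∈ LinearMap.range f)
    {s : Set M} (hs : Submodule.span R s = ⊤) (h : ∀ v ∈ s, MulStable f v) :
    Function.Surjective f := by
  have hst : ∀ v, MulStable f v := by
    intro v
    have hv : v ∈ Submodule.span R s := hs ▸ Submodule.mem_top
    induction hv using Submodule.span_induction with
    | mem v hv => exact h v hv
    | zero => intro x _; simp
    | add u v _ _ hu hv =>
      intro x hx
      rw [map_add, add_mul]
      exact Submodule.add_mem _ (hu x hx) (hv x hx)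
    | smul r v _ hv =>
      intro x hx
      rw [map_smul, smul_mul_assoc]
      exact Submodule.smul_mem _ _ (hv x hx)
  rw [← LinearMap.range_eq_top, eq_top_iff]
  rintro x -
  induction x using CliffordAlgebra.left_induction with
  | algebraMap r =>
    rw [Algebra.algebraMap_eq_smul_one]
    exact Submodule.smul_mem _ _ h1
  | add x y hx hy => exact Submodule.add_mem _ hx hy
  | ι_mul x v hx => exact hst v x hx

end Adjoin

section Real

open MvPolynomial

variable (W : Fin 6 → Fin 6 → GhostPoly)

/-- The generators as elements of the exterior algebra. -/
abbrev gen (k : Fin 6) : GhostAlgebra := ExteriorAlgebra.ι GhostPoly (W k)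

/-- The element of the exterior algebra with given coordinates in the first four generators. -/
def real4 : Kos4 GhostPoly →ₗ[GhostPoly] GhostAlgebra :=
  adjoinGen (gen W 3) (adjoinGen (gen W 2) (adjoinGen (gen W 1) (adjoinGen (gen W 0)
    (Algebra.linearMap GhostPoly GhostAlgebra))))

def real6 : (Kos4 GhostPoly × Kos4 GhostPoly) × (Kos4 GhostPoly × Kos4 GhostPoly) →ₗ[GhostPoly]
    GhostAlgebra :=
  adjoinGen (gen W 5) (adjoinGen (gen W 4) (real4 W))

/-- The six minors, in the order of the generators. -/
def minorVec : Fin 6 → GhostPoly :=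
  ![minor 0 2, minor 0 3, minor 1 2, minor 1 3, minor 0 1, minor 2 3]

variable {W}

lemma contract_real6 (ℓ : Module.Dual GhostPoly (Fin 6 → GhostPoly)) (x) :
    contract ℓ (real6 W x) = real6 W (cone (ℓ (W 5)) (cone (ℓ (W 4))
      (kos4 ![ℓ (W 0), ℓ (W 1), ℓ (W 2), ℓ (W 3)])) x) := by
  have h0 : ∀ x, contract ℓ (Algebra.linearMap GhostPoly GhostAlgebra x) =
      Algebra.linearMap GhostPoly GhostAlgebra ((0 : GhostPoly →ₗ[GhostPoly] GhostPoly) x) := by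
    intro x
    rw [LinearMap.zero_apply, map_zero]
    exact CliffordAlgebra.contractLeft_algebraMap ..
  have h4 : ∀ x, contract ℓ (real4 W x) =
      real4 W (kos4 ![ℓ (W 0), ℓ (W 1), ℓ (W 2), ℓ (W 3)] x) :=
    contract_adjoinGen (contract_adjoinGen (contract_adjoinGen (contract_adjoinGen h0)))
  exact contract_adjoinGen (contract_adjoinGen h4) x

lemma contract_real6_of_minor {ℓ : Module.Dual GhostPoly (Fin 6 → GhostPoly)}
    (hℓ : ∀ k, ℓ (W k) = minorVec k) (x) : contract ℓ (real6 W x) = real6 W (kos6 x) := by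
  rw [contract_real6, hℓ, hℓ, hℓ, hℓ, hℓ, hℓ]
  rfl

lemma real6_injective {δ : Fin 6 → Module.Dual GhostPoly (Fin 6 → GhostPoly)}
    (hδ : ∀ k l, δ k (W l) = if k = l then 1 else 0) : Function.Injective (real6 W) := by
  have h0 : ∀ k x, contract (δ k) (Algebra.linearMap GhostPoly GhostAlgebra x) = 0 :=
    fun k x => CliffordAlgebra.contractLeft_algebraMap ..
  have hne : ∀ k l, k ≠ l → δ k (W l) = 0 := fun k l h => by rw [hδ, if_neg h]
  have heq : ∀ k, δ k (W k) = 1 := fun k => by rw [hδ, if_pos rfl]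
  have i0 : Function.Injective (Algebra.linearMap GhostPoly GhostAlgebra) :=
    (ExteriorAlgebra.algebraMap_leftInverse (R := GhostPoly) (Fin 6 → GhostPoly)).injective
  have i1 := adjoinGen_injective (v := W 0) i0 (h0 0) (heq 0)
  have h1 := fun k (hk : k ≠ 0) => contract_adjoinGen_eq_zero (h0 k) (hne k 0 hk)
  have i2 := adjoinGen_injective (v := W 1) i1 (h1 1 (by decide)) (heq 1)
  have h2 := fun k (hk : k ≠ 0 ∧ k ≠ 1) => contract_adjoinGen_eq_zero (h1 k hk.1) (hne k 1 hk.2)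
  have i3 := adjoinGen_injective (v := W 2) i2 (h2 2 (by decide)) (heq 2)
  have h3 := fun k (hk : (k ≠ 0 ∧ k ≠ 1) ∧ k ≠ 2) =>
    contract_adjoinGen_eq_zero (h2 k hk.1) (hne k 2 hk.2)
  have i4 := adjoinGen_injective (v := W 3) i3 (h3 3 (by decide)) (heq 3)
  have h4 := fun k (hk : ((k ≠ 0 ∧ k ≠ 1) ∧ k ≠ 2) ∧ k ≠ 3) =>
    contract_adjoinGen_eq_zero (h3 k hk.1) (hne k 3 hk.2)
  have i5 := adjoinGen_injective (v := W 4) i4 (h4 4 (by decide)) (heq 4)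
  exact adjoinGen_injective (v := W 5) i5
    (contract_adjoinGen_eq_zero (h4 5 (by decide)) (hne 5 4 (by decide))) (heq 5)

lemma real6_surjective (hW : Submodule.span GhostPoly (Set.range W) = ⊤) :
    Function.Surjective (real6 W) := by
  refine surjective_of_mulStable ⟨((kosZero 1, 0), 0), by simp [real6, real4, kosZero]⟩ hW ?_
  rintro _ ⟨k, rfl⟩
  fin_cases k
  · exact (((((mulStable_adjoinGen_self _ _).adjoinGen _).adjoinGen _).adjoinGen _).adjoinGen
      _).adjoinGen _
  · exact ((((mulStable_adjoinGen_self _ _).adjoinGen _).adjoinGen _).adjoinGen _).adjoinGen _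
  · exact (((mulStable_adjoinGen_self _ _).adjoinGen _).adjoinGen _).adjoinGen _
  · exact ((mulStable_adjoinGen_self _ _).adjoinGen _).adjoinGen _
  · exact (mulStable_adjoinGen_self _ _).adjoinGen _
  · exact mulStable_adjoinGen_self _ _

end Real

end

/-! ### The basic cycles and the generation theorem -/

section

open MvPolynomial

section Forms

variable {S : Type*}

/-- The antisymmetric `4 × 4` matrix with entries `(0,2), (0,3), (1,2), (1,3), (0,1), (2,3)`. -/
def asymMat [Zero S] [Neg S] (f : Fin 6 → S) : Matrix (Fin 4) (Fin 4) S :=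
  !![0, f 4, f 0, f 1; -f 4, 0, f 2, f 3; -f 0, -f 2, 0, f 5; -f 1, -f 3, -f 5, 0]

/-- The dual of an antisymmetric matrix. -/
def hodge [Neg S] (f : Fin 6 → S) : Fin 6 → S := ![-f 3, f 2, f 1, -f 0, f 5, f 4]

/-- One third of the cubic matrix `f* f f*` for anticommuting entries `f`. -/
def cubicMat [Ring S] (f : Fin 6 → S) : Matrix (Fin 4) (Fin 4) S :=
  !![-(2 * (f 5 * (f 3 * f 2))), f 5 * (f 3 * f 0) - f 5 * (f 2 * f 1),
      f 5 * (f 4 * f 3) + f 3 * (f 2 * f 1), -(f 5 * (f 4 * f 2)) - f 3 * (f 2 * f 0);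
    f 5 * (f 3 * f 0) - f 5 * (f 2 * f 1), -(2 * (f 5 * (f 1 * f 0))),
      f 3 * (f 1 * f 0) - f 5 * (f 4 * f 1), f 5 * (f 4 * f 0) - f 2 * (f 1 * f 0);
    f 5 * (f 4 * f 3) + f 3 * (f 2 * f 1), f 3 * (f 1 * f 0) - f 5 * (f 4 * f 1),
      -(2 * (f 4 * (f 3 * f 1))), f 4 * (f 3 * f 0) + f 4 * (f 2 * f 1);
    -(f 5 * (f 4 * f 2)) - f 3 * (f 2 * f 0), f 5 * (f 4 * f 0) - f 2 * (f 1 * f 0),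
      f 4 * (f 3 * f 0) + f 4 * (f 2 * f 1), -(2 * (f 4 * (f 2 * f 0)))]

end Forms

variable (W : Fin 6 → Fin 6 → GhostPoly)

/-- The basic one-cycles. -/
def linForm (i : Fin 2) (t : Fin 4) : GhostAlgebra :=
  ∑ s, (X (i, s) : GhostPoly) • asymMat (hodge (gen W)) s t

/-- The basic three-cycles. -/
def cubicForm (i j : Fin 2) : GhostAlgebra :=
  ∑ s, ∑ t, (X (i, s) * X (j, t) : GhostPoly) • cubicMat (gen W) s t

/-- The pairs of entries of two rows. -/
def symProd (i j : Fin 2) (s t : Fin 4) : GhostPoly := X (i, s) * X (j, t) + X (j, s) * X (i, t)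

/-- Coordinates of `cubicForm`. -/
def cubicCoord (i j : Fin 2) :
    (Kos4 GhostPoly × Kos4 GhostPoly) × (Kos4 GhostPoly × Kos4 GhostPoly) :=
  ((-kos4 (blockProd i j + blockProd j i) (kosFour 1),
    -kosTwo ![0, 2 * (X (i, 3) * X (j, 3)),
      -(X (i, 2) * X (j, 3) + X (j, 2) * X (i, 3)), -(X (i, 2) * X (j, 3) + X (j, 2) * X (i, 3)),
      2 * (X (i, 2) * X (j, 2)), 0]),
   (-kosTwo ![2 * (X (i, 1) * X (j, 1)), 0, X (i, 0) * X (j, 1) + X (j, 0) * X (i, 1),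
      -(X (i, 0) * X (j, 1) + X (j, 0) * X (i, 1)), 0, 2 * (X (i, 0) * X (j, 0))],
    kosOne ![symProd i j 1 3, -symProd i j 1 2, -symProd i j 0 3, symProd i j 0 2]))

lemma real6_cubicCoord (i j : Fin 2) : real6 W (cubicCoord i j) = cubicForm W i j := by
  simp only [cubicForm, Fin.sum_univ_succ, Fin.sum_univ_zero, cubicMat]
  simp [real6, real4, cubicCoord, kos4, kosFour, kosTwo, kosOne, blockProd, symProd,
    Algebra.algebraMap_eq_smul_one, mul_add, two_mul]
  module

lemma real6_linForm (i : Fin 2) (t : Fin 4) : linForm W i t = real6 W (![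
    ((-kosOne ![0, 0, X (i, 3), -X (i, 2)], 0), (-kosZero (X (i, 1)), 0)),
    ((kosOne ![X (i, 3), -X (i, 2), 0, 0], 0), (kosZero (X (i, 0)), 0)),
    ((kosOne ![0, X (i, 1), 0, -X (i, 0)], -kosZero (X (i, 3))), 0),
    ((-kosOne ![X (i, 1), 0, -X (i, 0), 0], kosZero (X (i, 2))), 0)] t) := by
  fin_cases t <;>
  · simp [real6, real4, kosOne, kosZero, linForm, asymMat, hodge, Fin.sum_univ_succ,
      Algebra.algebraMap_eq_smul_one]
    try module

variable {W}

lemma kos6_cubicCoord (i j : Fin 2) : kos6 (cubicCoord i j) = 0 := by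
  fin_cases i <;> fin_cases j <;>
  · simp [kos6, cubicCoord, kos4, kosFour, kosTwo, kosOne, blockProd, symProd, mixedMinor, minor]
    (repeat' apply And.intro) <;> ring

lemma contract_cubicForm {ℓ : Module.Dual GhostPoly (Fin 6 → GhostPoly)}
    (hℓ : ∀ k, ℓ (W k) = minorVec k) (i j : Fin 2) : contract ℓ (cubicForm W i j) = 0 := by
  rw [← real6_cubicCoord, contract_real6_of_minor hℓ, kos6_cubicCoord, LinearMap.map_zero]

lemma contract_linForm {ℓ : Module.Dual GhostPoly (Fin 6 → GhostPoly)}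
    (hℓ : ∀ k, ℓ (W k) = minorVec k) (i : Fin 2) (t : Fin 4) : contract ℓ (linForm W i t) = 0 := by
  rw [real6_linForm, contract_real6_of_minor hℓ]
  convert LinearMap.map_zero (real6 W)
  fin_cases t <;> fin_cases i <;>
  · simp [kos6, kos4, kosOne, kosZero, mixedMinor, minor]
    ring

/-- Cycles for the six minors lie in every module of cycles that contains the boundaries and the
basic cycles. -/
lemma mem_of_contract_eq_zero {δ : Fin 6 → Module.Dual GhostPoly (Fin 6 → GhostPoly)}
    (hδ : ∀ k l, δ k (W l) = if k = l then 1 else 0)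
    (hW : Submodule.span GhostPoly (Set.range W) = ⊤)
    {ℓ : Module.Dual GhostPoly (Fin 6 → GhostPoly)} (hℓ : ∀ k, ℓ (W k) = minorVec k)
    {L : Submodule GhostPoly GhostAlgebra} (hd : ∀ x, contract ℓ x ∈ L)
    (hL : ∀ x ∈ L, contract ℓ x = 0) (h1 : 1 ∈ L) (hθ : ∀ i t, linForm W i t ∈ L)
    (hΘ : ∀ i j, cubicForm W i j ∈ L) (hΘ' : ∀ i j k, contract (δ k) (cubicForm W i j) ∈ L)
    {x : GhostAlgebra} (hx : contract ℓ x = 0) : x ∈ L := by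
  obtain ⟨x, rfl⟩ := real6_surjective hW x
  have hinj := real6_injective hδ
  set L' := L.comap (real6 W) with hL'
  set P := L'.map (LinearMap.fst GhostPoly _ _ ∘ₗ LinearMap.fst GhostPoly _ _) with hPdef
  have hP : ∀ p, p ∈ P ↔ ∃ y ∈ L', y.1.1 = p := fun p => Iff.rfl
  have himg : ∀ {y p}, real6 W y ∈ L → y.1.1 = p → p ∈ P := fun h h' => (hP _).mpr ⟨_, h, h'⟩
  have himg' : ∀ {y p}, real6 W y ∈ L → y.1.1 = -p → p ∈ P := fun h h' =>
    neg_mem_iff.mp (himg h h')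
  have hθ' := fun i t => real6_linForm W i t ▸ hθ i t
  -- Coordinates of the derivatives of the cubic cycles: contracting with `δ k` is the Koszul
  -- differential for the `k`-th unit vector.
  have hder := fun i j k => by
    have := hΘ' i j k
    rw [← real6_cubicCoord, contract_real6] at this
    exact this
  have hz : ∀ {y}, real6 W y = 0 → y = 0 := fun h => hinj (h.trans (LinearMap.map_zero _).symm)
  rw [contract_real6_of_minor hℓ] at hx
  refine mem_of_kos6_eq_zero (L := L') (P := P) (fun z => ?_) (fun y hy => ?_) hP ?_
    (fun i => himg' (hθ' i 3) rfl) (fun i => himg (hθ' i 2) rfl) (fun i => himg (hθ' i 1) rfl)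
    (fun i => himg' (hθ' i 0) rfl) (fun i j => himg' (hder i j 5) ?_)
    (fun i j => himg' (hder i j 4) ?_) (fun i j k => ?_)
    (fun i j => himg' (y := cubicCoord i j) ?_ rfl) (hz hx)
  · rw [hL', Submodule.mem_comap, ← contract_real6_of_minor hℓ]
    exact hd _
  · have := hL _ hy
    rw [contract_real6_of_minor hℓ] at this
    exact hz this
  · refine himg (y := ((kosZero 1, 0), 0)) ?_ rfl
    convert h1
    simp [real6, real4, kosZero]
  · simp [hδ, cubicCoord, kos4]
  · simp [hδ, cubicCoord, kos4]
  · have hk : ∀ (f g : Fin 4 → GhostPoly) (y : Kos4 GhostPoly),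
        kos4 f (-kos4 g y) = kos4 g (kos4 f y) := fun f g y => by
      have h := kos4_kos4 (f + g) y
      rw [kos4_add, kos4_add, map_add, map_add, kos4_kos4, kos4_kos4, zero_add, add_zero] at h
      rw [map_neg, neg_eq_iff_add_eq_zero, ← h]
    fin_cases k
    · refine himg (hder i j 3) ?_
      simp [hδ, cubicCoord, -map_add]
      rw [← map_neg, hk]
      congr 1
      simp [kos4, kosFour, kosThree]
    · refine himg' (hder i j 2) ?_
      simp [hδ, cubicCoord, -map_add]
      rw [← neg_inj, ← map_neg, hk, ← map_neg]
      congr 1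
      simp [kos4, kosFour, kosThree]
    · refine himg (hder i j 1) ?_
      simp [hδ, cubicCoord, -map_add]
      rw [← map_neg, hk]
      congr 1
      simp [kos4, kosFour, kosThree]
    · refine himg' (hder i j 0) ?_
      simp [hδ, cubicCoord, -map_add]
      rw [← neg_inj, ← map_neg, hk, ← map_neg]
      congr 1
      simp [kos4, kosFour, kosThree]
  · rw [real6_cubicCoord]
    exact hΘ i j

end

/-! ### Irreducibility of the gamma matrices and the transpose of the chirality matrix -/

section

section Commutant

variable {V : Type*} [AddCommGroup V] [Module ℂ V] [FiniteDimensional ℂ V]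

/-- Two anticommuting invertible endomorphisms split an invariant subspace into halves. -/
lemma exists_half_subspace (p : Submodule ℂ V) {g h : Module.End ℂ V} {α β : ℂ} (hα : α ≠ 0)
    (hβ : β ≠ 0) (hg : g * g = α • 1) (hh : h * h = β • 1) (hgh : h * g = -(g * h))
    (hgp : ∀ v ∈ p, g v ∈ p) (hhp : ∀ v ∈ p, h v ∈ p) :
    ∃ p' : Submodule ℂ V, Module.finrank ℂ p = 2 * Module.finrank ℂ p' ∧
      (∀ k : Module.End ℂ V, (∀ v ∈ p, k v ∈ p) → k * (g * h) = g * h * k → ∀ v ∈ p', k v ∈ p') ∧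
      ∀ (X : Module.End ℂ V) (c : ℂ), X * g = g * X → (∀ v ∈ p', X v = c • v) →
        ∀ v ∈ p, X v = c • v := by
  -- Chosen so that `s = r • (g * h)` is an involution. As `s` anticommutes with `g`, the map `g`
  -- exchanges its two eigenspaces, and these therefore have equal dimension on `p`.
  obtain ⟨r, hr⟩ := IsAlgClosed.exists_pow_nat_eq (-(α * β)⁻¹) (n := 2) (by norm_num)
  set s : Module.End ℂ V := r • (g * h) with hs
  have hss : s * s = 1 := by
    have h1 : g * h * (g * h) = (-(α * β)) • 1 := by
      rw [mul_assoc, ← mul_assoc h g h, hgh, neg_mul, mul_neg, mul_assoc, hh, mul_smul_comm,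
        mul_smul_comm, mul_one, hg, smul_smul, mul_comm β, neg_smul]
    rw [hs, smul_mul_smul_comm, h1, smul_smul, ← pow_two, hr, neg_mul_neg,
      inv_mul_cancel₀ (mul_ne_zero hα hβ), one_smul]
  have hsg : s * g = -(g * s) := by
    rw [hs, smul_mul_assoc, mul_assoc, hgh, mul_neg, smul_neg, mul_smul_comm]
  have hssv : ∀ v, s (s v) = v := fun v => by simpa using LinearMap.congr_fun hss v
  have hsgv : ∀ v, s (g v) = -g (s v) := fun v => by simpa using LinearMap.congr_fun hsg v
  have hggv : ∀ v, g (g v) = α • v := fun v => by simpa using LinearMap.congr_fun hg v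
  have hsp : ∀ v ∈ p, s v ∈ p := fun v hv => p.smul_mem r (hgp _ (hhp _ hv))
  have hginj : Function.Injective g := by
    intro v w hvw
    have := congrArg g hvw
    rw [hggv, hggv] at this
    exact smul_right_injective V hα this
  set p' : Submodule ℂ V := p ⊓ LinearMap.ker (s - 1) with hp'
  have hmem : ∀ v, v ∈ p' ↔ v ∈ p ∧ s v = v := fun v => by
    simp [hp', sub_eq_zero]
  have hdec : ∀ v ∈ p, ∃ x ∈ p', ∃ y ∈ p', v = x + g y := by
    intro v hv
    refine ⟨(1 / 2 : ℂ) • (v + s v), ?_, α⁻¹ • g ((1 / 2 : ℂ) • (v - s v)), ?_, ?_⟩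
    · rw [hmem]
      refine ⟨p.smul_mem _ (p.add_mem hv (hsp v hv)), ?_⟩
      rw [map_smul, map_add, hssv, add_comm]
    · rw [hmem]
      refine ⟨p.smul_mem _ (hgp _ (p.smul_mem _ (p.sub_mem hv (hsp v hv)))), ?_⟩
      rw [map_smul, hsgv, map_smul, map_sub, hssv, ← map_neg, ← smul_neg, neg_sub]
    · rw [map_smul, hggv, smul_smul, inv_mul_cancel₀ hα]
      module
  refine ⟨p', ?_, ?_, ?_⟩
  · have hsup : p' ⊔ p'.map g = p := by
      apply le_antisymm
      · refine sup_le inf_le_left ?_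
        rintro _ ⟨y, hy, rfl⟩
        exact hgp _ ((hmem y).mp hy).1
      · intro v hv
        obtain ⟨x, hx, y, hy, rfl⟩ := hdec v hv
        exact Submodule.add_mem_sup hx ⟨y, hy, rfl⟩
    have hinf : p' ⊓ p'.map g = ⊥ := by
      rw [eq_bot_iff]
      rintro _ ⟨hx, ⟨y, hy, rfl⟩⟩
      have h1 := ((hmem _).mp hx).2
      rw [hsgv, ((hmem y).mp hy).2] at h1
      have h2 : (2 : ℂ) • g y = 0 := by
        rw [two_smul]
        nth_rewrite 1 [← h1]
        exact neg_add_cancel _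
      exact (smul_eq_zero.mp h2).resolve_left two_ne_zero
    have h1 := Submodule.finrank_sup_add_finrank_inf_eq p' (p'.map g)
    rw [hsup, hinf, finrank_bot, add_zero,
      ← (Submodule.equivMapOfInjective g hginj p').finrank_eq] at h1
    omega
  · intro k hk hkgh v hv
    rw [hmem] at hv ⊢
    refine ⟨hk v hv.1, ?_⟩
    have h1 : k * s = s * k := by rw [hs, mul_smul_comm, hkgh, smul_mul_assoc]
    have h2 := LinearMap.congr_fun h1 v
    rw [Module.End.mul_apply, Module.End.mul_apply, hv.2] at h2
    exact h2.symm
  · intro X c hX hXp v hv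
    obtain ⟨x, hx, y, hy, rfl⟩ := hdec v hv
    have h1 : X (g y) = g (X y) := LinearMap.congr_fun hX y
    rw [map_add, h1, hXp x hx, hXp y hy, map_smul, smul_add]

/-- The commutant of six anticommuting invertible endomorphisms of an eight-dimensional space
consists of the scalars. -/
lemma exists_eq_smul_one_of_commute (hV : Module.finrank ℂ V = 8) {g : Fin 6 → Module.End ℂ V}
    {η : Fin 6 → ℂ} (hη : ∀ a, η a ≠ 0) (hsq : ∀ a, g a * g a = η a • 1)
    (hanti : ∀ a b, a ≠ b → g a * g b = -(g b * g a)) {X : Module.End ℂ V}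
    (hX : ∀ a, X * g a = g a * X) : ∃ c : ℂ, X = c • 1 := by
  have hcomm : ∀ a b c, a ≠ b → a ≠ c → g a * (g b * g c) = g b * g c * g a := by
    intro a b c hab hac
    rw [← mul_assoc, hanti a b hab, neg_mul, mul_assoc, hanti a c hac, mul_neg, neg_neg, mul_assoc]
  have hXc : ∀ b c, X * (g b * g c) = g b * g c * X := by
    intro b c
    rw [← mul_assoc, hX, mul_assoc, hX, mul_assoc]
  -- Three commuting involutions, from the pairs `(0,1)`, `(2,3)`, `(4,5)`, cut the dimension from
  -- `8` to `1`. On the final line `X` is a scalar, and commuting with `g 4`, `g 2`, `g 0` carries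
  -- this back to the whole space.
  obtain ⟨p₁, f₁, s₁, c₁⟩ := exists_half_subspace ⊤ (hη 0) (hη 1) (hsq 0) (hsq 1)
    (hanti 1 0 (by decide)) (fun _ _ => trivial) (fun _ _ => trivial)
  have st₁ : ∀ a, a ≠ 0 → a ≠ 1 → ∀ v ∈ p₁, g a v ∈ p₁ := fun a h0 h1 =>
    s₁ (g a) (fun _ _ => trivial) (hcomm a 0 1 h0 h1)
  obtain ⟨p₂, f₂, s₂, c₂⟩ := exists_half_subspace p₁ (hη 2) (hη 3) (hsq 2) (hsq 3)
    (hanti 3 2 (by decide)) (st₁ 2 (by decide) (by decide)) (st₁ 3 (by decide) (by decide))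
  have st₂ : ∀ a, a ≠ 0 → a ≠ 1 → a ≠ 2 → a ≠ 3 → ∀ v ∈ p₂, g a v ∈ p₂ := fun a h0 h1 h2 h3 =>
    s₂ (g a) (st₁ a h0 h1) (hcomm a 2 3 h2 h3)
  obtain ⟨p₃, f₃, s₃, c₃⟩ := exists_half_subspace p₂ (hη 4) (hη 5) (hsq 4) (hsq 5)
    (hanti 5 4 (by decide)) (st₂ 4 (by decide) (by decide) (by decide) (by decide))
    (st₂ 5 (by decide) (by decide) (by decide) (by decide))
  rw [finrank_top, hV] at f₁
  have hf : Module.finrank ℂ p₃ = 1 := by omega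
  obtain ⟨⟨v, hv⟩, -, hspan⟩ := finrank_eq_one_iff'.mp hf
  have hXp : ∀ w ∈ p₃, X w ∈ p₃ := s₃ X (s₂ X (s₁ X (fun _ _ => trivial) (hXc 0 1)) (hXc 2 3))
    (hXc 4 5)
  obtain ⟨c, hc⟩ := hspan ⟨X v, hXp v hv⟩
  have hc' : c • v = X v := congrArg Subtype.val hc
  refine ⟨c, ?_⟩
  have h3 : ∀ w ∈ p₃, X w = c • w := by
    intro w hw
    obtain ⟨d, hd⟩ := hspan ⟨w, hw⟩
    have hd' : d • v = w := congrArg Subtype.val hd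
    rw [← hd', map_smul, ← hc', smul_comm]
  have h2 := c₃ X c (hX 4) h3
  have h1 := c₂ X c (hX 2) h2
  have h0 := c₁ X c (hX 0) h1
  ext w
  simpa using h0 w trivial

end Commutant

lemma metric_mul_self (t : ℕ) (a : Fin 6) : metric t a * metric t a = 1 := by
  unfold metric
  split_ifs <;> simp

lemma metric_ne_zero (t : ℕ) (a : Fin 6) : metric t a ≠ 0 := fun h => by
  simpa [h] using metric_mul_self t a

namespace SpinorRep

variable {t : ℕ} (G : SpinorRep t)

lemma gamma_mul_self (a : Fin 6) : G.gamma a * G.gamma a = metric t a • 1 := by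
  have := G.clifford a a
  rw [if_pos rfl, ← two_smul ℂ (G.gamma a * G.gamma a), mul_smul] at this
  exact smul_right_injective _ two_ne_zero this

lemma gamma_mul_of_ne {a b : Fin 6} (h : a ≠ b) :
    G.gamma a * G.gamma b = -(G.gamma b * G.gamma a) := by
  have := G.clifford a b
  rw [if_neg h] at this
  exact eq_neg_of_add_eq_zero_left this

/-- A matrix commuting with all gamma matrices is a scalar. -/
lemma exists_eq_smul_one {X : Matrix (Fin 8) (Fin 8) ℂ}
    (hX : ∀ a, X * G.gamma a = G.gamma a * X) : ∃ c : ℂ, X = c • 1 := by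
  obtain ⟨c, hc⟩ := exists_eq_smul_one_of_commute (V := Fin 8 → ℂ) (by simp)
    (g := fun a => Matrix.toLinAlgEquiv' (G.gamma a)) (metric_ne_zero t)
    (fun a => by rw [← map_mul, gamma_mul_self, map_smul, map_one])
    (fun a b h => by rw [← map_mul, gamma_mul_of_ne G h, map_neg, map_mul])
    (X := Matrix.toLinAlgEquiv' X) (fun a => by rw [← map_mul, hX, map_mul])
  refine ⟨c, Matrix.toLinAlgEquiv'.injective ?_⟩
  rw [hc, map_smul, map_one]

/-- By irreducibility `chir` is a multiple of the product of all six gamma matrices. Transposition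
reverses the product and conjugates by `C`; the six signs from `charge_conj` cancel, and reversing
six anticommuting factors gives `(-1)^15 = -1`. Consequently `C⁻¹` pairs opposite chiralities and
`γ^a C⁻¹` equal ones. -/
lemma chir_transpose : G.chirᵀ = -(G.charge * G.chir * G.charge⁻¹) := by
  have anti : ∀ i j, i < j → G.gamma j * G.gamma i = -(G.gamma i * G.gamma j) :=
    fun i j h => G.gamma_mul_of_ne h.ne'
  have anti' : ∀ i j x, i < j → G.gamma j * (G.gamma i * x) = -(G.gamma i * (G.gamma j * x)) :=
    fun i j x h => by rw [← mul_assoc, anti i j h, neg_mul, mul_assoc]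
  have sq' : ∀ i x, G.gamma i * (G.gamma i * x) = metric t i • x := fun i x => by
    rw [← mul_assoc, gamma_mul_self, smul_mul_assoc, one_mul]
  set Γ := G.gamma 0 * G.gamma 1 * G.gamma 2 * G.gamma 3 * G.gamma 4 * G.gamma 5 with hΓ
  set Γ' := G.gamma 5 * G.gamma 4 * G.gamma 3 * G.gamma 2 * G.gamma 1 * G.gamma 0 with hΓ'
  have hrev : Γ' = -Γ := by
    simp [hΓ, hΓ', mul_assoc, anti, anti']
  have hΓg : ∀ a, Γ * G.gamma a = -(G.gamma a * Γ) := by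
    intro a
    fin_cases a <;> simp [hΓ, mul_assoc, anti, anti', sq', gamma_mul_self]
  have hinv : ∃ μ : ℂ, μ ≠ 0 ∧ Γ * Γ' = μ • 1 := by
    refine ⟨metric t 5 * metric t 4 * metric t 3 * metric t 2 * metric t 1 * metric t 0, ?_, ?_⟩
    · simp [metric_ne_zero]
    · simp only [hΓ, hΓ', mul_assoc, sq', gamma_mul_self, mul_smul_comm, smul_smul]
  obtain ⟨μ, hμ, hμ'⟩ := hinv
  -- Both `chir` and `Γ` anticommute with every gamma matrix, so their product commutes with all of
  -- them.
  obtain ⟨c, hc⟩ := G.exists_eq_smul_one (X := G.chir * Γ) (fun a => by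
    rw [mul_assoc, hΓg, mul_neg, ← mul_assoc, G.chir_anticomm, neg_mul, neg_neg, mul_assoc])
  have hchir : G.chir = (μ⁻¹ * c) • Γ' := by
    have := congrArg (fun Y => μ⁻¹ • (Y * Γ')) hc
    simpa [mul_assoc, hμ', smul_smul, inv_mul_cancel₀ hμ] using this
  have hCC : G.charge⁻¹ * G.charge = 1 := Matrix.nonsing_inv_mul _ G.charge_isUnit
  have hCC' : ∀ x, G.charge⁻¹ * (G.charge * x) = x := fun x => by rw [← mul_assoc, hCC, one_mul]
  have hT : Γ'ᵀ = G.charge * Γ * G.charge⁻¹ := by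
    simp only [hΓ', Matrix.transpose_mul, G.charge_conj, hΓ]
    simp [mul_assoc, hCC']
  rw [hchir, Matrix.transpose_smul, hT, hrev]
  simp

end SpinorRep

end

/-! ### Pfaffian duality and coordinates on Weyl spinors -/

section

open Matrix

/-- The polarized Pfaffian. -/
def pfPairing (f g : Fin 6 → ℂ) : ℂ := f ⬝ᵥ hodge g

/-- Polarization of the identity that an antisymmetric `4 × 4` matrix times its dual is minus its
Pfaffian times the identity. It is the Clifford relation in six dimensions in chiral form. -/
lemma asymMat_mul_hodge_add (f g : Fin 6 → ℂ) :
    asymMat f * asymMat (hodge g) + asymMat g * asymMat (hodge f) = (-pfPairing f g) • 1 := by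
  ext i j
  fin_cases i <;> fin_cases j <;>
  · simp [asymMat, hodge, pfPairing, Fin.sum_univ_succ, dotProduct]
    try ring

lemma asymMat_mul_hodge (f : Fin 6 → ℂ) :
    asymMat f * asymMat (hodge f) = (-(pfPairing f f / 2)) • 1 := by
  have h := asymMat_mul_hodge_add f f
  rw [← two_smul ℂ] at h
  apply smul_right_injective _ (two_ne_zero (α := ℂ))
  simp only [h, smul_smul]
  congr 1
  ring

lemma hodge_hodge (f : Fin 6 → ℂ) : hodge (hodge f) = f := by
  ext i
  fin_cases i <;> simp [hodge]

lemma asymMat_injective : Function.Injective (asymMat : (Fin 6 → ℂ) → _) := by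
  intro f g h
  have h' := fun s t => congrFun (congrFun h s) t
  ext i
  fin_cases i
  · simpa [asymMat] using h' 0 2
  · simpa [asymMat] using h' 0 3
  · simpa [asymMat] using h' 1 2
  · simpa [asymMat] using h' 1 3
  · simpa [asymMat] using h' 0 1
  · simpa [asymMat] using h' 2 3

lemma eq_asymMat {A : Matrix (Fin 4) (Fin 4) ℂ} (h : Aᵀ = -A) :
    A = asymMat ![A 0 2, A 0 3, A 1 2, A 1 3, A 0 1, A 2 3] := by
  have h' : ∀ s t, A t s = -A s t := fun s t => congrFun (congrFun h s) t
  have h0 : ∀ s, A s s = 0 := fun s => self_eq_neg.mp (h' s s)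
  ext s t
  fin_cases s <;> fin_cases t <;> simp [asymMat, h0] <;> exact h' _ _

/-- Antisymmetric invertible matrices satisfying the Clifford relations are orthogonal for the
Pfaffian, and their partners are the dual matrices. -/
lemma exists_clifford_dual {η : Fin 6 → ℂ} (hη : ∀ a, η a * η a = 1) {n : Fin 6 → Fin 6 → ℂ}
    {M : Fin 6 → Fin 6 → Matrix (Fin 4) (Fin 4) ℂ}
    (hdet : ∀ a, (asymMat (n a)).det ≠ 0)
    (hM : ∀ a b, M a b * asymMat (n b) = η b • asymMat (n a))
    (hcl : ∀ a b, M a b + M b a = if a = b then (2 * η a) • 1 else 0) :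
    ∃ c : ℂ, c ≠ 0 ∧ (∀ a b, M a b = c • (asymMat (n a) * asymMat (hodge (n b)))) ∧
      ∀ a b, pfPairing (n a) (n b) = if a = b then -2 / c * η a else 0 := by
  have hη0 : ∀ a, η a ≠ 0 := fun a h => by simpa [h] using hη a
  have hinv : ∀ a, IsUnit (asymMat (n a)) := fun a =>
    (Matrix.isUnit_iff_isUnit_det _).mpr (isUnit_iff_ne_zero.mpr (hdet a))
  have hpf : ∀ a, pfPairing (n a) (n a) ≠ 0 := by
    intro a ha
    have h1 := asymMat_mul_hodge (n a)
    rw [ha, zero_div, neg_zero, zero_smul] at h1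
    have h2 : asymMat (hodge (n a)) = 0 := (hinv a).mul_right_eq_zero.mp h1
    have h3 : asymMat (0 : Fin 6 → ℂ) = 0 := by
      ext s t
      fin_cases s <;> fin_cases t <;> simp [asymMat]
    have h4 : hodge (n a) = 0 := asymMat_injective (h2.trans h3.symm)
    have h5 : n a = 0 := by
      rw [← hodge_hodge (n a), h4]
      ext i
      fin_cases i <;> simp [hodge]
    apply hdet a
    rw [h5, h3]
    simp
  -- Multiplying `hM` on the right by the dual of `asymMat (n b)` and dividing by the nonzero
  -- Pfaffian solves for `M a b`; the factor may still depend on `b`.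
  have hMc : ∀ a b, M a b = (-2 * η b / pfPairing (n b) (n b)) •
      (asymMat (n a) * asymMat (hodge (n b))) := by
    intro a b
    have h1 := congrArg (· * asymMat (hodge (n b))) (hM a b)
    simp only [mul_assoc, asymMat_mul_hodge, smul_mul_assoc, mul_smul_comm, mul_one] at h1
    have h2 := congrArg ((-2 / pfPairing (n b) (n b)) • ·) h1
    simp only [smul_smul] at h2
    have h3 : -2 / pfPairing (n b) (n b) * -(pfPairing (n b) (n b) / 2) = 1 := by
      have := hpf b
      field_simp
    rw [h3, one_smul] at h2
    rw [h2]
    congr 1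
    ring
  set c : Fin 6 → ℂ := fun b => -2 * η b / pfPairing (n b) (n b) with hc
  have hc0 : ∀ b, c b ≠ 0 := fun b =>
    div_ne_zero (mul_ne_zero (by norm_num) (hη0 b)) (hpf b)
  have hsum : ∀ a b, a ≠ b → c b • (asymMat (n a) * asymMat (hodge (n b))) +
      c a • (asymMat (n b) * asymMat (hodge (n a))) = 0 := by
    intro a b h
    have := hcl a b
    rwa [if_neg h, hMc a b, hMc b a] at this
  -- If the factors differed, the Clifford relation and the polarized Pfaffian identity would be
  -- independent and force `asymMat (n a) * asymMat (hodge (n b))` to be a scalar, so `n a` would be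
  -- a multiple of `n b`. Comparing the Clifford relations of `a` and of `b` with a third index then
  -- gives an invertible matrix times the dual of `n b` equal to zero, against `hpf b`.
  have hceq : ∀ a b, c a = c b := by
    intro a b
    by_cases hab : a = b
    · rw [hab]
    by_contra hne
    have h1 := hsum a b hab
    have h2 := asymMat_mul_hodge_add (n a) (n b)
    obtain ⟨k, hk⟩ : ∃ k : ℂ, asymMat (n a) * asymMat (hodge (n b)) = k • 1 := by
      refine ⟨(c b - c a)⁻¹ * (c a * pfPairing (n a) (n b)), ?_⟩
      have h3 : (c b - c a) • (asymMat (n a) * asymMat (hodge (n b))) =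
          (c a * pfPairing (n a) (n b)) • 1 := by
        have h4 : (c a * pfPairing (n a) (n b)) • (1 : Matrix (Fin 4) (Fin 4) ℂ) =
          -(c a • ((-pfPairing (n a) (n b)) • 1)) := by module
        rw [h4, ← h2, sub_smul, ← sub_eq_zero, ← h1]
        module
      rw [mul_smul, ← h3, smul_smul, inv_mul_cancel₀ (sub_ne_zero.mpr (Ne.symm hne)), one_smul]
    have h3 : M a b = (c b * k) • 1 := by rw [hMc, hk, smul_smul]
    have h4 := hM a b
    rw [h3, smul_mul_assoc, one_mul] at h4
    have h5 : asymMat (n a) = (η b * (c b * k)) • asymMat (n b) := by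
      rw [mul_smul, h4, smul_smul, hη, one_smul]
    set x := η b * (c b * k) with hx
    have h6 : n a = x • n b := by
      apply asymMat_injective
      rw [h5]
      ext s t
      fin_cases s <;> fin_cases t <;> simp [asymMat]
    have h7 : asymMat (hodge (n a)) = x • asymMat (hodge (n b)) := by
      rw [h6]
      ext s t
      fin_cases s <;> fin_cases t <;> simp [asymMat, hodge]
    obtain ⟨d, hda, hdb⟩ : ∃ d : Fin 6, d ≠ a ∧ d ≠ b := by
      clear * -
      revert a b
      decide
    have h8 := hsum a d hda.symm
    have h9 := hsum b d hdb.symm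
    rw [h5, h7] at h8
    have h10 : ((c a - c b) * x) • (asymMat (n d) * asymMat (hodge (n b))) = 0 := by
      have : ((c a - c b) * x) • (asymMat (n d) * asymMat (hodge (n b))) =
          (c d • (x • asymMat (n b) * asymMat (hodge (n d))) +
            c a • (asymMat (n d) * x • asymMat (hodge (n b)))) -
          x • (c d • (asymMat (n b) * asymMat (hodge (n d))) +
            c b • (asymMat (n d) * asymMat (hodge (n b)))) := by
        rw [smul_mul_assoc, mul_smul_comm]
        module
      rw [this, h8, h9, smul_zero, sub_zero]
    have hx0 : x ≠ 0 := by
      intro h0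
      apply hdet a
      rw [h5, h0, zero_smul]
      simp
    rw [smul_eq_zero, or_iff_right (mul_ne_zero (sub_ne_zero.mpr hne) hx0),
      (hinv d).mul_right_eq_zero] at h10
    have h11 := asymMat_mul_hodge (n b)
    rw [h10, mul_zero] at h11
    have h12 := congrFun (congrFun h11 0) 0
    simp at h12
    exact hpf b h12
  refine ⟨c 0, hc0 0, fun a b => by rw [hMc a b, hceq 0 b], fun a b => ?_⟩
  have h1 := hcl a b
  rw [hMc a b, hMc b a] at h1
  change c b • _ + c a • _ = _ at h1
  rw [hceq b 0, hceq a 0, ← smul_add, asymMat_mul_hodge_add, smul_smul] at h1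
  have h2 := congrFun (congrFun h1 0) 0
  have hc00 := hc0 0
  split_ifs at h2 ⊢ with h
  · simp at h2
    field_simp
    linear_combination -h2
  · simp [hc00] at h2
    exact h2

namespace SpinorRep

variable {t : ℕ} {G : SpinorRep t} {ε : ℤˣ}

lemma mem_weylSpinors {χ : Fin 8 → ℂ} :
    χ ∈ G.weylSpinors ε ↔ χ ᵥ* G.chir = ((ε : ℤ) : ℂ) • χ := by
  rw [weylSpinors, Module.End.mem_eigenspace_iff]
  rfl

lemma sign_mul_self (ε : ℤˣ) : (((ε : ℤ) : ℂ)) * ((ε : ℤ) : ℂ) = 1 := by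
  rcases Int.units_eq_one_or ε with rfl | rfl <;> simp

variable (e : Module.Basis (Fin 4) ℂ (G.weylSpinors ε))

/-- Spinors of the opposite chirality are determined by their pairings with `weylSpinors ε`. -/
lemma exists_dual_family : ∃ F : Fin 4 → Fin 8 → ℂ, ∀ χ : Fin 8 → ℂ,
    χ ᵥ* G.chir = -((ε : ℤ) : ℂ) • χ →
      χ = ∑ s, (χ ᵥ* G.charge⁻¹ ⬝ᵥ (e s : Fin 8 → ℂ)) • F s := by
  set σ : ℂ := ((ε : ℤ) : ℂ) with hσ
  have hσσ : σ * σ = 1 := sign_mul_self ε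
  -- Twice the projector onto chirality `ε`. Its rows are Weyl spinors, and by `chir_transpose` its
  -- transpose acts as `2` on `χ C⁻¹` when `χ` has the opposite chirality.
  set Q : Matrix (Fin 8) (Fin 8) ℂ := 1 + σ • G.chir with hQ
  have hQmem : ∀ α, Q α ∈ G.weylSpinors ε := by
    intro α
    rw [mem_weylSpinors]
    have h : Q * G.chir = σ • Q := by
      rw [hQ, add_mul, smul_mul_assoc, G.chir_sq, one_mul, smul_add, smul_smul, hσσ, one_smul,
        add_comm]
    exact congrFun h α
  set l : Fin 8 → Fin 4 → ℂ := fun α s => e.repr ⟨Q α, hQmem α⟩ s with hl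
  have hQl : ∀ α, Q α = ∑ s, l α s • (e s : Fin 8 → ℂ) := by
    intro α
    have := congrArg Subtype.val (e.sum_repr ⟨Q α, hQmem α⟩)
    rw [Submodule.coe_sum] at this
    exact this.symm
  refine ⟨fun s => (1 / 2 : ℂ) • ((fun α => l α s) ᵥ* G.charge), fun χ hχ => ?_⟩
  have h1 : χ ᵥ* G.charge⁻¹ ᵥ* Qᵀ = (2 : ℂ) • (χ ᵥ* G.charge⁻¹) := by
    have hCC : G.charge⁻¹ * G.charge = 1 := Matrix.nonsing_inv_mul _ G.charge_isUnit
    have h2 : G.charge⁻¹ * Qᵀ = (1 - σ • G.chir) * G.charge⁻¹ := by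
      rw [hQ, transpose_add, transpose_one, transpose_smul, chir_transpose, mul_add, mul_one,
        mul_smul_comm, mul_neg, ← mul_assoc, ← mul_assoc, hCC, one_mul, sub_mul, one_mul,
        smul_neg, smul_mul_assoc, sub_eq_add_neg]
    rw [vecMul_vecMul, h2, ← vecMul_vecMul, vecMul_sub, vecMul_one, vecMul_smul, hχ, smul_smul,
      mul_neg, hσσ, neg_smul, one_smul, sub_neg_eq_add, ← two_smul ℂ, smul_vecMul]
  have h3 : χ ᵥ* G.charge⁻¹ ᵥ* Qᵀ =
      ∑ s, (χ ᵥ* G.charge⁻¹ ⬝ᵥ (e s : Fin 8 → ℂ)) • fun α => l α s := by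
    ext α
    rw [vecMul_transpose, mulVec, dotProduct_comm, hQl, dotProduct_sum, Finset.sum_apply]
    refine Finset.sum_congr rfl fun s _ => ?_
    rw [dotProduct_smul, Pi.smul_apply, smul_eq_mul, smul_eq_mul, mul_comm]
  have h4 : χ = (1 / 2 : ℂ) • (χ ᵥ* G.charge⁻¹ ᵥ* Qᵀ ᵥ* G.charge) := by
    have hCC : G.charge⁻¹ * G.charge = 1 := Matrix.nonsing_inv_mul _ G.charge_isUnit
    rw [h1, smul_vecMul, smul_smul, vecMul_vecMul, hCC, vecMul_one]
    norm_num
  conv_lhs => rw [h4, h3]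
  rw [sum_vecMul, Finset.smul_sum]
  refine Finset.sum_congr rfl fun s _ => ?_
  rw [smul_vecMul, smul_comm]

/-- The coordinates of the matrices `γ^a C⁻¹` on `weylSpinors ε`. -/
def weylForm (a : Fin 6) : Matrix (Fin 4) (Fin 4) ℂ := fun s t =>
  (e s : Fin 8 → ℂ) ᵥ* G.gamma a ᵥ* G.charge⁻¹ ⬝ᵥ (e t : Fin 8 → ℂ)

lemma vecMul_gamma_vecMul_chir {χ : Fin 8 → ℂ} {σ : ℂ} (h : χ ᵥ* G.chir = σ • χ) (a : Fin 6) :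
    χ ᵥ* G.gamma a ᵥ* G.chir = -σ • (χ ᵥ* G.gamma a) := by
  have h1 : G.gamma a * G.chir = -(G.chir * G.gamma a) := by rw [G.chir_anticomm, neg_neg]
  rw [vecMul_vecMul, h1, vecMul_neg, ← vecMul_vecMul, h, smul_vecMul, neg_smul]

/-- `γ^a C⁻¹` is antisymmetric by the symmetry of `C` together with `charge_conj`. -/
lemma weylForm_transpose (a : Fin 6) : (weylForm e a)ᵀ = -weylForm e a := by
  have hCC : G.charge⁻¹ * G.charge = 1 := Matrix.nonsing_inv_mul _ G.charge_isUnit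
  have hCT : G.charge⁻¹ᵀ = G.charge⁻¹ := by rw [transpose_nonsing_inv, G.charge_symm]
  have h : (G.gamma a * G.charge⁻¹)ᵀ = -(G.gamma a * G.charge⁻¹) := by
    rw [transpose_mul, hCT, G.charge_conj, mul_neg, ← mul_assoc, ← mul_assoc, hCC, one_mul]
  ext s t
  change (e t : Fin 8 → ℂ) ᵥ* G.gamma a ᵥ* G.charge⁻¹ ⬝ᵥ (e s : Fin 8 → ℂ) =
    -((e s : Fin 8 → ℂ) ᵥ* G.gamma a ᵥ* G.charge⁻¹ ⬝ᵥ (e t : Fin 8 → ℂ))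
  rw [vecMul_vecMul, vecMul_vecMul, ← dotProduct_mulVec, dotProduct_comm, ← vecMul_transpose, h,
    vecMul_neg, neg_dotProduct]

lemma sum_smul_eq_zero {v : Fin 4 → ℂ} (h : ∑ s, v s • (e s : Fin 8 → ℂ) = 0) : v = 0 := by
  have h1 : ∑ s, v s • e s = 0 := Subtype.ext (by rw [Submodule.coe_sum]; exact h)
  ext s
  exact Fintype.linearIndependent_iff.mp e.linearIndependent v h1 s

/-- Coordinates in which the gamma matrices act on Weyl spinors by antisymmetric matrices and
their duals. -/
lemma exists_weyl_coords : ∃ (n : Fin 6 → Fin 6 → ℂ) (c : ℂ) (F : Fin 4 → Fin 8 → ℂ), c ≠ 0 ∧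
    (∀ a, weylForm e a = asymMat (n a)) ∧
    (∀ a s, (e s : Fin 8 → ℂ) ᵥ* G.gamma a = ∑ u, asymMat (n a) s u • F u) ∧
    (∀ a b d s u, (e s : Fin 8 → ℂ) ᵥ* (G.gamma a * G.gamma b * G.gamma d * G.charge⁻¹) ⬝ᵥ
        (e u : Fin 8 → ℂ) = c * (asymMat (n a) * asymMat (hodge (n b)) * asymMat (n d)) s u) ∧
    ∀ a b, pfPairing (n a) (n b) = if a = b then -2 / c * metric t a else 0 := by
  obtain ⟨F, hF⟩ := exists_dual_family e
  set σ : ℂ := ((ε : ℤ) : ℂ) with hσ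
  have he : ∀ s, (e s : Fin 8 → ℂ) ᵥ* G.chir = σ • (e s : Fin 8 → ℂ) := fun s =>
    mem_weylSpinors.mp (e s).2
  have hF' : ∀ a s, (e s : Fin 8 → ℂ) ᵥ* G.gamma a = ∑ u, weylForm e a s u • F u := fun a s =>
    hF _ (vecMul_gamma_vecMul_chir (he s) a)
  set n : Fin 6 → Fin 6 → ℂ := fun a => ![weylForm e a 0 2, weylForm e a 0 3, weylForm e a 1 2,
    weylForm e a 1 3, weylForm e a 0 1, weylForm e a 2 3] with hn
  have hnA : ∀ a, weylForm e a = asymMat (n a) := fun a => eq_asymMat (weylForm_transpose e a)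
  -- A vector in the left kernel gives a Weyl spinor annihilated by `γ^a`, and `γ^a` squares to a
  -- nonzero scalar.
  have hdet : ∀ a, (asymMat (n a)).det ≠ 0 := by
    intro a hdet
    obtain ⟨v, hv, hva⟩ := Matrix.exists_vecMul_eq_zero_iff.mpr hdet
    apply hv
    apply sum_smul_eq_zero e
    have h1 : (∑ s, v s • (e s : Fin 8 → ℂ)) ᵥ* G.gamma a = 0 := by
      rw [sum_vecMul]
      simp only [smul_vecMul, hF', Finset.smul_sum, smul_smul]
      rw [Finset.sum_comm]
      refine Finset.sum_eq_zero fun u _ => ?_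
      rw [← Finset.sum_smul, hnA]
      have := congrFun hva u
      rw [vecMul, dotProduct] at this
      rw [this, Pi.zero_apply, zero_smul]
    have h2 := congrArg (· ᵥ* G.gamma a) h1
    simp only [vecMul_vecMul, gamma_mul_self, zero_vecMul, vecMul_smul, vecMul_one] at h2
    exact (smul_eq_zero.mp h2).resolve_left (metric_ne_zero t a)
  have hmem : ∀ a b s, (e s : Fin 8 → ℂ) ᵥ* G.gamma a ᵥ* G.gamma b ∈ G.weylSpinors ε := by
    intro a b s
    rw [mem_weylSpinors, vecMul_gamma_vecMul_chir (vecMul_gamma_vecMul_chir (he s) a) b, neg_neg]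
  -- `M a b` is the matrix of `γ^a γ^b` on Weyl spinors; two gamma matrices preserve chirality.
  set M : Fin 6 → Fin 6 → Matrix (Fin 4) (Fin 4) ℂ := fun a b s u =>
    e.repr ⟨_, hmem a b s⟩ u with hMdef
  have hMe : ∀ a b s, (e s : Fin 8 → ℂ) ᵥ* G.gamma a ᵥ* G.gamma b =
      ∑ u, M a b s u • (e u : Fin 8 → ℂ) := by
    intro a b s
    have := congrArg Subtype.val (e.sum_repr ⟨_, hmem a b s⟩)
    rw [Submodule.coe_sum] at this
    exact this.symm
  have hM3 : ∀ a b d s u, (e s : Fin 8 → ℂ) ᵥ* (G.gamma a * G.gamma b * G.gamma d * G.charge⁻¹) ⬝ᵥ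
        (e u : Fin 8 → ℂ) = (M a b * asymMat (n d)) s u := by
    intro a b d s u
    simp only [← vecMul_vecMul, hMe, sum_vecMul, smul_vecMul, sum_dotProduct, smul_dotProduct]
    rw [Matrix.mul_apply]
    refine Finset.sum_congr rfl fun r _ => ?_
    rw [← hnA]
    rfl
  have hM : ∀ a b, M a b * asymMat (n b) = metric t b • asymMat (n a) := by
    intro a b
    ext s u
    rw [← hM3, mul_assoc (G.gamma a), gamma_mul_self, ← hnA]
    simp only [mul_smul_comm, mul_one, smul_mul_assoc, vecMul_smul, smul_dotProduct]
    rw [← vecMul_vecMul]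
    rfl
  have hcl : ∀ a b, M a b + M b a = if a = b then (2 * metric t a) • 1 else 0 := by
    intro a b
    ext s u
    have h1 : ∑ r, (M a b + M b a - if a = b then (2 * metric t a) • 1 else 0) s r •
        (e r : Fin 8 → ℂ) = 0 := by
      have h2 := congrArg ((e s : Fin 8 → ℂ) ᵥ* ·) (G.clifford a b)
      simp only [vecMul_add, ← vecMul_vecMul, hMe] at h2
      have h3 : ∑ r, (if a = b then (2 * metric t a) • (1 : Matrix (Fin 4) (Fin 4) ℂ) else 0) s r •
          (e r : Fin 8 → ℂ) = (e s : Fin 8 → ℂ) ᵥ* if a = b then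
            (2 * metric t a) • (1 : Matrix (Fin 8) (Fin 8) ℂ) else 0 := by
        split_ifs
        · simp [vecMul_smul, Matrix.one_apply, ite_smul]
        · simp
      simp only [Matrix.sub_apply, Matrix.add_apply, sub_smul, add_smul, Finset.sum_add_distrib,
        Finset.sum_sub_distrib, h2, h3, sub_self]
    have h4 := congrFun (sum_smul_eq_zero e h1) u
    rw [Matrix.sub_apply, Pi.zero_apply, sub_eq_zero] at h4
    exact h4
  obtain ⟨c, hc, hMc, hpf⟩ := exists_clifford_dual (metric_mul_self t) hdet hM hcl
  refine ⟨n, c, F, hc, hnA, fun a s => by rw [hF', hnA], fun a b d s u => ?_, hpf⟩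
  rw [hM3, hMc, smul_mul_assoc, Matrix.smul_apply, smul_eq_mul]

end SpinorRep

end

/-! ### The frame of translation ghosts adapted to the minors -/

section

open MvPolynomial

section Forms

variable {ι M : Type*} [Fintype ι] [AddCommGroup M] [Module GhostPoly M]

lemma hodge_sum (m : ι → Fin 6 → ℂ) (x : ι → M) :
    hodge (fun k => ∑ a, (C (m a k) : GhostPoly) • x a) =
      fun k => ∑ a, (C (hodge (m a) k) : GhostPoly) • x a := by
  ext k
  fin_cases k <;> simp [hodge]

lemma asymMat_sum (m : ι → Fin 6 → ℂ) (x : ι → M) (s t : Fin 4) :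
    asymMat (fun k => ∑ a, (C (m a k) : GhostPoly) • x a) s t =
      ∑ a, (C (asymMat (m a) s t) : GhostPoly) • x a := by
  fin_cases s <;> fin_cases t <;> simp [asymMat]

lemma asymMat_mul_left (r : ℂ) (f : Fin 6 → ℂ) (s t : Fin 4) :
    asymMat (fun k => r * f k) s t = r * asymMat f s t := by
  fin_cases s <;> fin_cases t <;> simp [asymMat]

lemma hodge_mul_left (r : ℂ) (f : Fin 6 → ℂ) :
    hodge (fun k => r * f k) = fun k => r * hodge f k := by
  ext k
  fin_cases k <;> simp [hodge]

end Forms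

lemma sum_hodge_mul_asymMat (W : Fin 6 → Fin 6 → GhostPoly) (s t : Fin 4) :
    ∑ u, ∑ v, asymMat (hodge (gen W)) s u * (asymMat (gen W) u v * asymMat (hodge (gen W)) v t) =
      (3 : GhostPoly) • cubicMat (gen W) s t := by
  generalize hg : gen W = g
  have hsq : ∀ i, g i * g i = 0 := fun i => by
    rw [← hg]
    exact ExteriorAlgebra.ι_sq_zero _
  have hsq' : ∀ i x, g i * (g i * x) = 0 := fun i x => by rw [← mul_assoc, hsq, zero_mul]
  -- Restricted to `i < j` so that rewriting sorts products into decreasing order, the order used in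
  -- `cubicMat`.
  have anti : ∀ i j, i < j → g i * g j = -(g j * g i) := fun i j _ => by
    rw [← hg]
    exact eq_neg_of_add_eq_zero_left (ExteriorAlgebra.ι_add_mul_swap _ _)
  have anti' : ∀ i j x, i < j → g i * (g j * x) = -(g j * (g i * x)) := fun i j x h => by
    rw [← mul_assoc, anti i j h, neg_mul, mul_assoc]
  fin_cases s <;> fin_cases t <;>
  · simp [Fin.sum_univ_succ, asymMat, hodge, cubicMat, hsq, hsq', anti, anti', two_mul]
    module

/-- The vectors of linear translation ghosts attached to coordinates `n` of the gamma matrices. -/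
def ghostFrame (η : Fin 6 → ℂ) (κ : ℂ) (n : Fin 6 → Fin 6 → ℂ) (k a : Fin 6) : GhostPoly :=
  C ((Complex.I * κ)⁻¹ * η a * hodge (n a) k)

/-- The dual linear forms. -/
def ghostCoframe (n : Fin 6 → Fin 6 → ℂ) (k : Fin 6) : Module.Dual GhostPoly (Fin 6 → GhostPoly) :=
  ∑ a, (C (Complex.I * n a k) : GhostPoly) • LinearMap.proj a

section Frame

variable {η : Fin 6 → ℂ} {κ : ℂ} {n : Fin 6 → Fin 6 → ℂ}

lemma gen_ghostFrame (k : Fin 6) : gen (ghostFrame η κ n) k =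
    ∑ a, (C ((Complex.I * κ)⁻¹ * η a * hodge (n a) k) : GhostPoly) • transGhost a := by
  have h : ghostFrame η κ n k =
      ∑ a, (C ((Complex.I * κ)⁻¹ * η a * hodge (n a) k) : GhostPoly) • Pi.single a 1 := by
    ext1 b
    simp [ghostFrame, Finset.sum_apply, Pi.single_apply]
  rw [gen, h, map_sum]
  simp only [map_smul, transGhost]

lemma asymMat_gen_ghostFrame (hκ : κ ≠ 0) (s t : Fin 4) :
    ∑ a, (C (η a * asymMat (hodge (n a)) s t) : GhostPoly) • transGhost a =
      (C (Complex.I * κ) : GhostPoly) • asymMat (gen (ghostFrame η κ n)) s t := by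
  have h : gen (ghostFrame η κ n) = fun k => ∑ a,
      (C (((Complex.I * κ)⁻¹ * η a) * hodge (n a) k) : GhostPoly) • transGhost a :=
    funext gen_ghostFrame
  rw [h, asymMat_sum, Finset.smul_sum]
  refine Finset.sum_congr rfl fun a _ => ?_
  rw [asymMat_mul_left, smul_smul, ← C_mul, ← mul_assoc, ← mul_assoc,
    mul_inv_cancel₀ (mul_ne_zero Complex.I_ne_zero hκ), one_mul]

lemma asymMat_hodge_gen_ghostFrame (hκ : κ ≠ 0) (s t : Fin 4) :
    ∑ a, (C (η a * asymMat (n a) s t) : GhostPoly) • transGhost a =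
      (C (Complex.I * κ) : GhostPoly) • asymMat (hodge (gen (ghostFrame η κ n))) s t := by
  have h : gen (ghostFrame η κ n) = fun k => ∑ a,
      (C (((Complex.I * κ)⁻¹ * η a) * hodge (n a) k) : GhostPoly) • transGhost a :=
    funext gen_ghostFrame
  rw [h, hodge_sum, asymMat_sum, Finset.smul_sum]
  refine Finset.sum_congr rfl fun a _ => ?_
  rw [hodge_mul_left, hodge_hodge, asymMat_mul_left, smul_smul, ← C_mul, ← mul_assoc, ← mul_assoc,
    mul_inv_cancel₀ (mul_ne_zero Complex.I_ne_zero hκ), one_mul]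

variable (hκ : κ ≠ 0) (hη : ∀ a, η a * η a = 1)
  (hn : ∀ a b, pfPairing (n a) (n b) = if a = b then κ * η a else 0)

include hκ hη hn

lemma sum_mul_hodge (a b : Fin 6) :
    ∑ k, n a k * (κ⁻¹ * η b * hodge (n b) k) = if a = b then 1 else 0 := by
  have h := hn a b
  rw [pfPairing, dotProduct] at h
  have h2 : ∑ k, n a k * (κ⁻¹ * η b * hodge (n b) k) = κ⁻¹ * η b * ∑ k, n a k * hodge (n b) k := by
    rw [Finset.mul_sum]
    exact Finset.sum_congr rfl fun k _ => by ring
  rw [h2, h]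
  split_ifs with hab
  · subst hab
    have := hη a
    field_simp
    linear_combination this
  · rw [mul_zero]

/-- The Fierz identity. -/
lemma sum_hodge_mul (k l : Fin 6) :
    ∑ a, n a k * (κ⁻¹ * η a * hodge (n a) l) = if k = l then 1 else 0 := by
  have h1 : Matrix.of n * (Matrix.of fun k b => κ⁻¹ * η b * hodge (n b) k) = 1 := by
    ext a b
    rw [Matrix.mul_apply, Matrix.one_apply]
    exact sum_mul_hodge hκ hη hn a b
  rw [mul_eq_one_comm] at h1
  have h2 := congrFun (congrFun h1 l) k
  rw [Matrix.mul_apply, Matrix.one_apply] at h2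
  simp only [Matrix.of_apply] at h2
  simp only [eq_comm (a := k), ← h2]
  exact Finset.sum_congr rfl fun a _ => mul_comm _ _

/-- The factor `I` in the coframe is the one that `σ₂` produces in `b`; the frame carries its
inverse, so duality reduces to the Fierz identity. -/
lemma ghostCoframe_ghostFrame (k l : Fin 6) :
    ghostCoframe n k (ghostFrame η κ n l) = if k = l then 1 else 0 := by
  have h : ∀ a, C (Complex.I * n a k) * C ((Complex.I * κ)⁻¹ * η a * hodge (n a) l) =
      (C (n a k * (κ⁻¹ * η a * hodge (n a) l)) : GhostPoly) := by
    intro a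
    rw [← C_mul]
    congr 1
    have := Complex.I_ne_zero
    field_simp
  simp only [ghostCoframe, LinearMap.sum_apply, LinearMap.smul_apply, LinearMap.proj_apply,
    ghostFrame, smul_eq_mul, h, ← map_sum, sum_hodge_mul hκ hη hn]
  split_ifs <;> simp

lemma span_ghostFrame : Submodule.span GhostPoly (Set.range (ghostFrame η κ n)) = ⊤ := by
  have h : ∀ a, (Pi.single a 1 : Fin 6 → GhostPoly) =
      ∑ k, (C (Complex.I * n a k) : GhostPoly) • ghostFrame η κ n k := by
    intro a
    ext1 b
    have h : ∀ k, C (Complex.I * n a k) * C ((Complex.I * κ)⁻¹ * η b * hodge (n b) k) =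
        (C (n a k * (κ⁻¹ * η b * hodge (n b) k)) : GhostPoly) := by
      intro k
      rw [← C_mul]
      congr 1
      have := Complex.I_ne_zero
      field_simp
    simp only [Finset.sum_apply, Pi.smul_apply, ghostFrame, smul_eq_mul, h, ← map_sum,
      sum_mul_hodge hκ hη hn, Pi.single_apply]
    simp only [eq_comm (a := b)]
    split_ifs <;> simp
  rw [eq_top_iff, ← (Pi.basisFun GhostPoly (Fin 6)).span_eq, Submodule.span_le]
  rintro _ ⟨a, rfl⟩
  rw [Pi.basisFun_apply, h]
  exact Submodule.sum_mem _ fun k _ => Submodule.smul_mem _ _ (Submodule.subset_span ⟨k, rfl⟩)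

/-- A linear form with coefficients in the minors, evaluated on the frame. -/
lemma sum_minor_ghostFrame (m : Fin 6 → GhostPoly) (l : Fin 6) :
    (∑ a, (∑ k, C (Complex.I * n a k) * m k) • LinearMap.proj a :
      Module.Dual GhostPoly (Fin 6 → GhostPoly)) (ghostFrame η κ n l) = m l := by
  have h : (∑ a, (∑ k, C (Complex.I * n a k) * m k) • LinearMap.proj a :
      Module.Dual GhostPoly (Fin 6 → GhostPoly)) = ∑ k, m k • ghostCoframe n k := by
    simp only [ghostCoframe, Finset.sum_smul, Finset.smul_sum, smul_smul]
    rw [Finset.sum_comm]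
    simp only [mul_comm]
  rw [h]
  simp [ghostCoframe_ghostFrame hκ hη hn]

end Frame

end

/-! ### Translation of `b`, `ϑ` and `Θ` and the final equivalence -/

section

open MvPolynomial

lemma sum_fin_three {M : Type*} [AddCommMonoid M] {α : Type*} [Fintype α] (f : (Fin 3 → α) → M) :
    ∑ a, f a = ∑ x, ∑ y, ∑ z, f ![x, y, z] := by
  rw [← Fintype.sum_prod_type', ← Fintype.sum_prod_type']
  refine Fintype.sum_equiv
    ⟨fun a => ((a 0, a 1), a 2), fun p => ![p.1.1, p.1.2, p.2], fun a => ?_, fun p => rfl⟩ _ _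
    fun a => ?_
  · ext1 k
    fin_cases k <;> rfl
  · congr 1
    ext1 k
    fin_cases k <;> rfl

lemma sum_comm_four {M : Type*} [AddCommMonoid M] {α β γ δ : Type*} [Fintype α] [Fintype β]
    [Fintype γ] [Fintype δ] (f : α → β → γ → δ → M) :
    ∑ a, ∑ b, ∑ c, ∑ d, f a b c d = ∑ d, ∑ c, ∑ b, ∑ a, f a b c d := by
  have h : ∑ p : α × β, ∑ q : γ × δ, f p.1 p.2 q.1 q.2 =
      ∑ q : γ × δ, ∑ p : α × β, f p.1 p.2 q.1 q.2 := Finset.sum_comm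
  simp only [Fintype.sum_prod_type] at h
  rw [h, Finset.sum_comm]
  exact Finset.sum_congr rfl fun _ _ => Finset.sum_congr rfl fun _ _ => Finset.sum_comm

lemma sum_comm_three_two {M : Type*} [AddCommMonoid M] {α β γ δ τ : Type*} [Fintype α] [Fintype β]
    [Fintype γ] [Fintype δ] [Fintype τ] (f : α → β → γ → δ → τ → M) :
    ∑ x, ∑ y, ∑ z, ∑ u, ∑ v, f x y z u v = ∑ u, ∑ v, ∑ x, ∑ y, ∑ z, f x y z u v := by
  have h : ∑ p : α × β × γ, ∑ q : δ × τ, f p.1 p.2.1 p.2.2 q.1 q.2 =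
      ∑ q : δ × τ, ∑ p : α × β × γ, f p.1 p.2.1 p.2.2 q.1 q.2 := Finset.sum_comm
  simpa only [Fintype.sum_prod_type] using h

lemma sum_mul_sum_mul_sum {R : Type*} [Ring R] {α β γ : Type*} [Fintype α] [Fintype β]
    [Fintype γ] (f : α → R) (g : β → R) (h : γ → R) :
    (∑ x, f x) * ((∑ y, g y) * ∑ z, h z) = ∑ x, ∑ y, ∑ z, f x * (g y * h z) := by
  rw [Finset.sum_mul, Finset.sum_mul_sum]
  simp only [Finset.mul_sum]

/-- Products of translation ghosts are antisymmetric. -/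
lemma prod_transGhost_perm {p : ℕ} (σ : Equiv.Perm (Fin p)) (a : Fin p → Fin 6) :
    (List.ofFn fun k => transGhost (a (σ k))).prod =
      (C ((Equiv.Perm.sign σ : ℤ) : ℂ) : GhostPoly) • (List.ofFn fun k => transGhost (a k)).prod := by
  have h := (ExteriorAlgebra.ιMulti GhostPoly p).map_perm
    (fun k => (Pi.single (a k) 1 : Fin 6 → GhostPoly)) σ
  rw [ExteriorAlgebra.ιMulti_apply, ExteriorAlgebra.ιMulti_apply] at h
  refine h.trans ?_
  rcases Int.units_eq_one_or (Equiv.Perm.sign σ) with hs | hs <;> rw [hs] <;> simp [transGhost]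

namespace SpinorRep

variable {t : ℕ} {G : SpinorRep t} {ε : ℤˣ} (e : Module.Basis (Fin 4) ℂ (G.weylSpinors ε))

lemma bilin_eq_sum (i j : Fin 2) (A : Matrix (Fin 8) (Fin 8) ℂ) : bilin e i j A =
    ∑ s, ∑ u, C ((e s : Fin 8 → ℂ) ᵥ* (A * G.charge⁻¹) ⬝ᵥ (e u : Fin 8 → ℂ)) *
      (X (i, s) * X (j, u)) := by
  simp only [bilin, susyGhost, Matrix.vecMul, dotProduct, map_sum, map_mul, Finset.mul_sum,
    Finset.sum_mul]
  rw [sum_comm_four]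
  refine Finset.sum_congr rfl fun s _ => Finset.sum_congr rfl fun u _ =>
    Finset.sum_congr rfl fun β _ => Finset.sum_congr rfl fun α _ => ?_
  ring

/-- `bilin` as a linear map in the matrix. -/
def bilinLin (i j : Fin 2) : Matrix (Fin 8) (Fin 8) ℂ →ₗ[ℂ] GhostPoly where
  toFun := bilin e i j
  map_add' A B := by
    simp only [bilin, add_mul, Matrix.add_apply, map_add, Finset.sum_add_distrib]
  map_smul' r A := by
    simp only [bilin, smul_mul_assoc, Matrix.smul_apply, smul_eq_mul, C_mul, RingHom.id_apply,
      Finset.smul_sum, smul_eq_C_mul, mul_assoc]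

/-- The bilinear of `γ^a` is antisymmetric in the two ghosts and expands in the minors with
coefficients `n a k`. The two off-diagonal entries of `σ₂` contribute equally, and with the
prefactor `-1/2` they add up to `I`. -/
lemma cobdry_eq_contract {n : Fin 6 → Fin 6 → ℂ} (hn : ∀ a, weylForm e a = asymMat (n a)) :
    cobdry e = contract
      (∑ a, (∑ k, C (Complex.I * n a k) * minorVec k) • LinearMap.proj a) := by
  have hb : ∀ i j a, bilin e i j (G.gamma a) = ∑ s, ∑ u, C (asymMat (n a) s u) *
      (X (i, s) * X (j, u)) := by
    intro i j a
    rw [bilin_eq_sum]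
    refine Finset.sum_congr rfl fun s _ => Finset.sum_congr rfl fun u _ => ?_
    rw [← hn, weylForm, Matrix.vecMul_vecMul]
  have hb01 : ∀ a, bilin e 0 1 (G.gamma a) = ∑ k, C (n a k) * minorVec k := by
    intro a
    rw [hb]
    simp [Fin.sum_univ_succ, asymMat, minorVec, minor]
    ring
  have hb10 : ∀ a, bilin e 1 0 (G.gamma a) = -∑ k, C (n a k) * minorVec k := by
    intro a
    rw [hb]
    simp [Fin.sum_univ_succ, asymMat, minorVec, minor]
    ring
  have hcoef : ∀ a, ∑ i, ∑ j, C (-(1 / 2 : ℂ) * sigma2 i j) * bilin e i j (G.gamma a) =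
      ∑ k, C (Complex.I * n a k) * minorVec k := by
    intro a
    simp only [Fin.sum_univ_two, hb01, hb10, C_mul (a := Complex.I), mul_assoc (C Complex.I),
      ← Finset.mul_sum, sigma2]
    simp only [Matrix.of_apply, Matrix.cons_val_zero, Matrix.cons_val_one, Matrix.cons_val_fin_one,
      mul_zero, map_zero, zero_mul, zero_add, add_zero]
    have h : (C Complex.I : GhostPoly) =
        C (-(1 / 2) * -Complex.I) - C (-(1 / 2) * Complex.I) := by
      rw [← C_sub]
      congr 1
      ring
    rw [h]
    ring
  rw [contract, map_sum, cobdry]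
  refine Finset.sum_congr rfl fun a _ => ?_
  rw [map_smul, hcoef]
  rfl

lemma contract_ghostCoframe (n : Fin 6 → Fin 6 → ℂ) (k : Fin 6) (x : GhostAlgebra) :
    contract (ghostCoframe n k) x = ∑ a, (C (Complex.I * n a k) : GhostPoly) • transDeriv a x := by
  rw [contract, ghostCoframe, map_sum, LinearMap.sum_apply]
  refine Finset.sum_congr rfl fun a _ => ?_
  rw [map_smul]
  rfl

/-- Contractions with linear forms anticommute. Derivatives of cocycles are therefore cocycles. -/
lemma transDeriv_cobdry (a : Fin 6) (x : GhostAlgebra) :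
    cobdry e (transDeriv a x) = -transDeriv a (cobdry e x) := by
  simp only [cobdry, LinearMap.sum_apply, LinearMap.smul_apply, map_sum, map_smul,
    ← Finset.sum_neg_distrib, ← smul_neg]
  refine Finset.sum_congr rfl fun b _ => ?_
  congr 1
  exact CliffordAlgebra.contractLeft_comm ..

/-- The translation ghosts already antisymmetrize: relabelling the sum for each permutation produces
a sign that cancels the one in `gammaAsym`, so the `p!` terms are equal. -/
lemma Theta_eq_sum (p : ℕ) (i j : Fin 2) : Theta e p i j =
    ∑ a : Fin p → Fin 6, (C ((p ! : ℂ)⁻¹) * bilin e i j (List.ofFn fun k => G.gammaLow (a k)).prod) •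
      (List.ofFn fun k => transGhost (a k)).prod := by
  set B : (Fin p → Fin 6) → GhostPoly :=
    fun a => bilin e i j (List.ofFn fun k => G.gammaLow (a k)).prod with hB
  set P : (Fin p → Fin 6) → GhostAlgebra := fun a => (List.ofFn fun k => transGhost (a k)).prod
    with hP
  have hBA : ∀ a : Fin p → Fin 6, bilin e i j (G.gammaAsym a) =
      C ((p ! : ℂ)⁻¹) * ∑ σ : Equiv.Perm (Fin p), C ((Equiv.Perm.sign σ : ℤ) : ℂ) * B (a ∘ σ) := by
    intro a
    change bilinLin e i j (G.gammaAsym a) = _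
    rw [gammaAsym, map_smul, map_sum, smul_eq_C_mul]
    congr 1
    refine Finset.sum_congr rfl fun σ _ => ?_
    rw [map_smul, smul_eq_C_mul]
    rfl
  have hsum : ∑ a, (∑ σ : Equiv.Perm (Fin p), C ((Equiv.Perm.sign σ : ℤ) : ℂ) * B (a ∘ σ)) • P a =
      (C (p ! : ℂ) : GhostPoly) • ∑ a, B a • P a := by
    simp only [Finset.sum_smul]
    rw [Finset.sum_comm]
    have h : ∀ σ : Equiv.Perm (Fin p),
        ∑ a, (C ((Equiv.Perm.sign σ : ℤ) : ℂ) * B (a ∘ σ)) • P a = ∑ a, B a • P a := by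
      intro σ
      rw [← (Equiv.arrowCongr σ.symm (Equiv.refl (Fin 6))).sum_comp fun a => B a • P a]
      refine Finset.sum_congr rfl fun a _ => ?_
      rw [mul_comm, mul_smul, ← prod_transGhost_perm]
      rfl
    simp only [h, Finset.sum_const, Finset.card_univ, Fintype.card_perm, Fintype.card_fin]
    rw [map_natCast, Nat.cast_smul_eq_nsmul]
  have h1 : Theta e p i j = (C ((p ! : ℂ)⁻¹) : GhostPoly) • (C ((p ! : ℂ)⁻¹) : GhostPoly) •
      ∑ a, (∑ σ : Equiv.Perm (Fin p), C ((Equiv.Perm.sign σ : ℤ) : ℂ) * B (a ∘ σ)) • P a := by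
    simp only [Theta, hBA, Finset.smul_sum, smul_smul, hP]
  rw [h1, hsum, smul_smul (C ((p ! : ℂ)⁻¹) : GhostPoly) (C (p ! : ℂ)), ← C_mul,
    inv_mul_cancel₀ (Nat.cast_ne_zero.mpr p.factorial_ne_zero), C_1, one_smul, Finset.smul_sum]
  simp only [smul_smul, hB, hP]

variable {e} {n : Fin 6 → Fin 6 → ℂ} {κ : ℂ}

section

variable {F : Fin 4 → Fin 8 → ℂ} (hκ : κ ≠ 0)

include hκ

lemma vartheta_eq_sum
    (hF : ∀ a s, (e s : Fin 8 → ℂ) ᵥ* G.gamma a = ∑ u, asymMat (n a) s u • F u)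
    (i : Fin 2) (α : Fin 8) : vartheta e i α =
      ∑ u, (C (Complex.I * κ * F u α) : GhostPoly) •
        linForm (ghostFrame (metric t) κ n) i u := by
  have h1 : ∀ a, (∑ β : Fin 8, C (G.gammaLow a β α) * susyGhost e i β) =
      ∑ u, ∑ s, C (F u α) * X (i, s) * C (metric t a * asymMat (n a) s u) := by
    intro a
    have h2 : ∀ s, ∑ β, (e s : Fin 8 → ℂ) β * G.gamma a β α = ∑ u, asymMat (n a) s u * F u α := by
      intro s
      have := congrFun (hF a s) α
      simpa [Matrix.vecMul, dotProduct, Finset.sum_apply] using this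
    simp only [susyGhost, Finset.mul_sum, gammaLow, Matrix.smul_apply, smul_eq_mul]
    rw [Finset.sum_comm, Finset.sum_comm (f := fun u s => C (F u α) * X (i, s) * _)]
    refine Finset.sum_congr rfl fun s _ => ?_
    have h3 : ∀ u, C (F u α) * X (i, s) * C (metric t a * asymMat (n a) s u) =
        C (metric t a) * X (i, s) * (C (asymMat (n a) s u * F u α) : GhostPoly) := by
      intro u
      simp only [C_mul]
      ring
    have h4 : ∀ β, C (metric t a * G.gamma a β α) * (C ((e s : Fin 8 → ℂ) β) * X (i, s)) =
        C (metric t a) * X (i, s) * (C ((e s : Fin 8 → ℂ) β * G.gamma a β α) : GhostPoly) := by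
      intro β
      simp only [C_mul]
      ring
    simp only [h3, h4, ← Finset.mul_sum, ← map_sum, h2]
  simp only [vartheta, h1, Finset.sum_smul, mul_smul _ (C (metric t _ * _))]
  rw [Finset.sum_comm]
  refine Finset.sum_congr rfl fun u _ => ?_
  rw [Finset.sum_comm, linForm, Finset.smul_sum]
  refine Finset.sum_congr rfl fun s _ => ?_
  rw [← Finset.smul_sum, asymMat_hodge_gen_ghostFrame hκ, smul_smul, smul_smul]
  congr 1
  simp only [C_mul]
  ring

/-- Inverse to `vartheta_eq_sum`: pairing the free spinor index with `C⁻¹ e_u` recovers the linear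
cycle. That lemma shows `ϑ` to be a cocycle; this one puts the linear cycles in the span of the `ϑ`.
-/
lemma linForm_eq_sum (hn : ∀ a, weylForm e a = asymMat (n a)) (i : Fin 2) (u : Fin 4) :
    linForm (ghostFrame (metric t) κ n) i u =
      ∑ α, (C ((Complex.I * κ)⁻¹ * (G.charge⁻¹ *ᵥ (e u : Fin 8 → ℂ)) α) : GhostPoly) •
        vartheta e i α := by
  set v := G.charge⁻¹ *ᵥ (e u : Fin 8 → ℂ) with hv
  have h2 : ∀ a s, ∑ α, v α * ∑ β, (e s : Fin 8 → ℂ) β * G.gamma a β α = asymMat (n a) s u := by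
    intro a s
    rw [← hn, weylForm, ← Matrix.dotProduct_mulVec, ← hv, dotProduct_comm]
    rfl
  have h1 : ∀ a, ∑ α, C (v α) * ∑ β : Fin 8, C (G.gammaLow a β α) * susyGhost e i β =
      ∑ s, X (i, s) * C (metric t a * asymMat (n a) s u) := by
    intro a
    simp only [← h2, susyGhost, Finset.mul_sum, gammaLow, Matrix.smul_apply, smul_eq_mul, map_sum]
    rw [Finset.sum_congr rfl fun α _ => Finset.sum_comm, Finset.sum_comm]
    refine Finset.sum_congr rfl fun s _ => Finset.sum_congr rfl fun α _ =>
      Finset.sum_congr rfl fun β _ => ?_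
    simp only [C_mul]
    ring
  have h3 : ∑ α, (C (v α) : GhostPoly) • vartheta e i α =
      (C (Complex.I * κ) : GhostPoly) • linForm (ghostFrame (metric t) κ n) i u := by
    simp only [vartheta, Finset.smul_sum, smul_smul]
    rw [Finset.sum_comm]
    simp only [← Finset.sum_smul, h1]
    simp only [Finset.sum_smul, mul_smul]
    rw [Finset.sum_comm, linForm, Finset.smul_sum]
    refine Finset.sum_congr rfl fun s _ => ?_
    rw [← Finset.smul_sum, asymMat_hodge_gen_ghostFrame hκ, smul_comm]
  simp only [C_mul (a := (Complex.I * κ)⁻¹), mul_smul]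
  rw [← Finset.smul_sum, h3, smul_smul, ← C_mul,
    inv_mul_cancel₀ (mul_ne_zero Complex.I_ne_zero hκ), C_1, one_smul]

/-- A product of three gamma matrices acts as `c` times matrix, dual, matrix; contraction with the
ghosts gives `I * κ` for each factor. The `1/2` is `3 / 3!`, because `cubicMat` is a third of the
matrix product. -/
lemma Theta_eq_smul {c : ℂ} (hM : ∀ a b d s u, (e s : Fin 8 → ℂ) ᵥ*
      (G.gamma a * G.gamma b * G.gamma d * G.charge⁻¹) ⬝ᵥ (e u : Fin 8 → ℂ) =
        c * (asymMat (n a) * asymMat (hodge (n b)) * asymMat (n d)) s u) (i j : Fin 2) :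
    Theta e 3 i j = (C (c * (Complex.I * κ) ^ 3 / 2) : GhostPoly) •
      cubicForm (ghostFrame (metric t) κ n) i j := by
  set W := ghostFrame (metric t) κ n with hW
  set D : Fin 6 → Fin 4 → Fin 4 → GhostPoly := fun a s u => C (metric t a * asymMat (n a) s u)
    with hD
  set D' : Fin 6 → Fin 4 → Fin 4 → GhostPoly :=
    fun a s u => C (metric t a * asymMat (hodge (n a)) s u) with hD'
  have h1 : ∀ x y z, bilin e i j (G.gammaLow x * (G.gammaLow y * G.gammaLow z)) =
      ∑ s, ∑ r, (C c * (X (i, s) * X (j, r))) * ∑ u, ∑ v, D x s u * (D' y u v * D z v r) := by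
    intro x y z
    rw [bilin_eq_sum]
    refine Finset.sum_congr rfl fun s _ => Finset.sum_congr rfl fun r _ => ?_
    have h : G.gammaLow x * (G.gammaLow y * G.gammaLow z) * G.charge⁻¹ =
        (metric t x * metric t y * metric t z) •
          (G.gamma x * G.gamma y * G.gamma z * G.charge⁻¹) := by
      simp only [gammaLow, smul_mul_assoc, mul_smul_comm, smul_smul, mul_assoc]
      congr 1
      ring
    rw [h, Matrix.vecMul_smul, smul_dotProduct, hM, mul_assoc (asymMat (n x)), Matrix.mul_apply]
    simp only [Matrix.mul_apply, smul_eq_mul, Finset.mul_sum, map_sum, Finset.sum_mul, hD, hD']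
    refine Finset.sum_congr rfl fun u _ => Finset.sum_congr rfl fun v _ => ?_
    simp only [C_mul]
    ring
  have h2 : ∀ s r, ∑ x, ∑ y, ∑ z, (∑ u, ∑ v, D x s u * (D' y u v * D z v r)) •
      (transGhost x * (transGhost y * transGhost z)) =
      (C ((Complex.I * κ) ^ 3) * 3 : GhostPoly) • cubicMat (gen W) s r := by
    intro s r
    have h3 : ∀ u v, ∑ x, ∑ y, ∑ z, (D x s u * (D' y u v * D z v r)) •
        (transGhost x * (transGhost y * transGhost z)) =
        (C ((Complex.I * κ) ^ 3) : GhostPoly) • (asymMat (hodge (gen W)) s u *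
          (asymMat (gen W) u v * asymMat (hodge (gen W)) v r)) := by
      intro u v
      have h4 : (∑ x, D x s u • transGhost x) * ((∑ y, D' y u v • transGhost y) *
          ∑ z, D z v r • transGhost z) = (C ((Complex.I * κ) ^ 3) : GhostPoly) •
            (asymMat (hodge (gen W)) s u *
              (asymMat (gen W) u v * asymMat (hodge (gen W)) v r)) := by
        have hDs : ∀ s u, ∑ x, D x s u • transGhost x =
            (C (Complex.I * κ) : GhostPoly) • asymMat (hodge (gen W)) s u := fun s u =>
          asymMat_hodge_gen_ghostFrame hκ s u
        have hDs' : ∀ s u, ∑ x, D' x s u • transGhost x =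
            (C (Complex.I * κ) : GhostPoly) • asymMat (gen W) s u := fun s u =>
          asymMat_gen_ghostFrame hκ s u
        rw [hDs, hDs, hDs']
        simp only [smul_mul_assoc, mul_smul_comm, smul_smul, ← C_mul]
        congr 2
        ring
      rw [← h4, sum_mul_sum_mul_sum]
      refine Finset.sum_congr rfl fun x _ => Finset.sum_congr rfl fun y _ =>
        Finset.sum_congr rfl fun z _ => ?_
      simp only [smul_mul_assoc, mul_smul_comm, smul_smul]
      congr 1
      ring
    rw [mul_smul, ← sum_hodge_mul_asymMat]
    simp only [Finset.smul_sum, ← h3, Finset.sum_smul]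
    exact sum_comm_three_two _
  rw [Theta_eq_sum, sum_fin_three]
  have h5 : ∀ x y z : Fin 6,
      (List.ofFn fun k => G.gammaLow (![x, y, z] k)).prod =
        G.gammaLow x * (G.gammaLow y * G.gammaLow z) := fun x y z => by
    simp [List.ofFn_succ]
  have h6 : ∀ x y z : Fin 6, (List.ofFn fun k => transGhost (![x, y, z] k)).prod =
      transGhost x * (transGhost y * transGhost z) := fun x y z => by
    simp [List.ofFn_succ]
  have h9 : ∀ x y z : Fin 6, (C ((3 ! : ℂ)⁻¹) *
      bilin e i j (List.ofFn fun k => G.gammaLow (![x, y, z] k)).prod) •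
        (List.ofFn fun k => transGhost (![x, y, z] k)).prod =
      ∑ s, ∑ r, (C ((3 ! : ℂ)⁻¹) * (C c * (X (i, s) * X (j, r))) : GhostPoly) •
        (∑ u, ∑ v, D x s u * (D' y u v * D z v r)) •
          (transGhost x * (transGhost y * transGhost z)) := by
    intro x y z
    rw [h5, h6, h1]
    simp only [Finset.mul_sum (s := Finset.univ (α := Fin 4)) (a := C ((3 ! : ℂ)⁻¹)), smul_smul,
      ← Finset.sum_smul, mul_assoc]
  rw [Finset.sum_congr rfl fun x _ => Finset.sum_congr rfl fun y _ =>
    Finset.sum_congr rfl fun z _ => h9 x y z, sum_comm_three_two, cubicForm, Finset.smul_sum]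
  refine Finset.sum_congr rfl fun s _ => ?_
  rw [Finset.smul_sum]
  refine Finset.sum_congr rfl fun r _ => ?_
  rw [Finset.sum_congr rfl fun x _ => Finset.sum_congr rfl fun y _ => Finset.smul_sum.symm,
    Finset.sum_congr rfl fun x _ => Finset.smul_sum.symm, ← Finset.smul_sum, h2, smul_smul,
    smul_smul]
  congr 1
  have h7 : (C (c * (Complex.I * κ) ^ 3 / 2) : GhostPoly) =
      C ((3 ! : ℂ)⁻¹) * C c * C ((Complex.I * κ) ^ 3) * C 3 := by
    simp only [← C_mul]
    congr 1
    norm_num [Nat.factorial]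
    ring
  have h8 : (C 3 : GhostPoly) = 3 := map_ofNat C 3
  rw [h7, h8]
  ring

end

/-- The cocycles of the coboundary operator, up to equivalence. -/
theorem cobdry_eq_zero_iff (e : Module.Basis (Fin 4) ℂ (G.weylSpinors ε)) (ω : GhostAlgebra) :
    cobdry e ω = 0 ↔
      ∃ (p₃ : Fin 2 → Fin 2 → GhostPoly) (p₂ : Fin 2 → Fin 2 → Fin 6 → GhostPoly)
        (p₁ : Fin 2 → Fin 8 → GhostPoly) (p₀ : GhostPoly),
        Equivalent e ω
          ((∑ i, ∑ j, p₃ i j • Theta e 3 i j) +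
            (∑ i, ∑ j, ∑ a, p₂ i j a • ThetaDeriv e 3 i j a) +
            (∑ i, ∑ α, p₁ i α • vartheta e i α) +
            algebraMap GhostPoly GhostAlgebra p₀) := by
  obtain ⟨n, c, F, hc, hnA, hF, hM, hpf⟩ := exists_weyl_coords e
  have hκ : (-2 / c : ℂ) ≠ 0 := div_ne_zero (by norm_num) hc
  set κ : ℂ := -2 / c with hκdef
  set W := ghostFrame (metric t) κ n with hW
  have hδ := ghostCoframe_ghostFrame hκ (metric_mul_self t) hpf
  have hspan := span_ghostFrame hκ (metric_mul_self t) hpf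
  have hℓ := sum_minor_ghostFrame hκ (metric_mul_self t) hpf minorVec
  rw [← hW] at hspan
  have hb : cobdry e = contract _ := cobdry_eq_contract e hnA
  set ℓ : Module.Dual GhostPoly (Fin 6 → GhostPoly) :=
    ∑ a, (∑ k, C (Complex.I * n a k) * minorVec k) • LinearMap.proj a with hℓdef
  have hΘ := Theta_eq_smul (e := e) hκ hM
  have hlam : c * (Complex.I * κ) ^ 3 / 2 ≠ 0 := by simp [hc, hκ]
  have hθcyc : ∀ i α, cobdry e (vartheta e i α) = 0 := by
    intro i α
    rw [vartheta_eq_sum hκ hF, hb, map_sum]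
    refine Finset.sum_eq_zero fun u _ => ?_
    rw [map_smul, contract_linForm hℓ, smul_zero]
  have hΘcyc : ∀ i j, cobdry e (Theta e 3 i j) = 0 := by
    intro i j
    rw [hΘ, hb, map_smul, contract_cubicForm hℓ, smul_zero]
  have hΘ'cyc : ∀ i j a, cobdry e (ThetaDeriv e 3 i j a) = 0 := by
    intro i j a
    rw [ThetaDeriv, transDeriv_cobdry, hΘcyc, map_zero, neg_zero]
  have h0cyc : ∀ p, cobdry e (algebraMap GhostPoly GhostAlgebra p) = 0 := by
    intro p
    rw [hb]
    exact CliffordAlgebra.contractLeft_algebraMap ..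
  have hbb : ∀ x, cobdry e (cobdry e x) = 0 := by
    intro x
    rw [hb]
    exact CliffordAlgebra.contractLeft_contractLeft ..
  constructor
  · intro hω
    -- The elements of the asserted form, with the coboundaries included; the generation theorem is
    -- applied to this module.
    set L : Submodule GhostPoly GhostAlgebra :=
      LinearMap.range (cobdry e) ⊔
        (Submodule.span GhostPoly (Set.range fun p : Fin 2 × Fin 2 => Theta e 3 p.1 p.2) ⊔
        Submodule.span GhostPoly
          (Set.range fun p : (Fin 2 × Fin 2) × Fin 6 => ThetaDeriv e 3 p.1.1 p.1.2 p.2) ⊔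
        Submodule.span GhostPoly (Set.range fun p : Fin 2 × Fin 8 => vartheta e p.1 p.2) ⊔
        LinearMap.range (Algebra.linearMap GhostPoly GhostAlgebra)) with hLdef
    have hLb : ∀ x, cobdry e x ∈ L := fun x => Submodule.mem_sup_left ⟨x, rfl⟩
    have hLΘ : ∀ i j, Theta e 3 i j ∈ L := fun i j => Submodule.mem_sup_right <|
      Submodule.mem_sup_left <| Submodule.mem_sup_left <| Submodule.mem_sup_left <|
      Submodule.subset_span ⟨(i, j), rfl⟩
    have hLΘ' : ∀ i j a, ThetaDeriv e 3 i j a ∈ L := fun i j a => Submodule.mem_sup_right <|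
      Submodule.mem_sup_left <| Submodule.mem_sup_left <| Submodule.mem_sup_right <|
      Submodule.subset_span ⟨((i, j), a), rfl⟩
    have hLθ : ∀ i α, vartheta e i α ∈ L := fun i α => Submodule.mem_sup_right <|
      Submodule.mem_sup_left <| Submodule.mem_sup_right <| Submodule.subset_span ⟨(i, α), rfl⟩
    have hL0 : ∀ p, algebraMap GhostPoly GhostAlgebra p ∈ L := fun p => Submodule.mem_sup_right <|
      Submodule.mem_sup_right ⟨p, rfl⟩
    have hLker : L ≤ LinearMap.ker (cobdry e) := by
      refine sup_le ?_ (sup_le (sup_le (sup_le ?_ ?_) ?_) ?_)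
      · rintro _ ⟨x, rfl⟩
        exact hbb x
      · rw [Submodule.span_le]
        rintro _ ⟨p, rfl⟩
        simpa only [SetLike.mem_coe, LinearMap.mem_ker] using hΘcyc p.1 p.2
      · rw [Submodule.span_le]
        rintro _ ⟨p, rfl⟩
        simpa only [SetLike.mem_coe, LinearMap.mem_ker] using hΘ'cyc p.1.1 p.1.2 p.2
      · rw [Submodule.span_le]
        rintro _ ⟨p, rfl⟩
        simpa only [SetLike.mem_coe, LinearMap.mem_ker] using hθcyc p.1 p.2
      · rintro _ ⟨p, rfl⟩
        exact h0cyc p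
    have hcub : ∀ i j, cubicForm W i j =
        (C (c * (Complex.I * κ) ^ 3 / 2)⁻¹ : GhostPoly) • Theta e 3 i j := by
      intro i j
      rw [hΘ, smul_smul, ← C_mul, inv_mul_cancel₀ hlam, C_1, one_smul]
    have hωL : ω ∈ L := by
      refine mem_of_contract_eq_zero hδ hspan hℓ (L := L) (fun x => hb ▸ hLb x)
        (fun x hx => hb ▸ hLker hx) (by simpa using hL0 1) (fun i u => ?_) (fun i j => ?_)
        (fun i j k => ?_) (hb ▸ hω)
      · rw [linForm_eq_sum hκ hnA]
        exact L.sum_mem fun α _ => L.smul_mem _ (hLθ i α)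
      · rw [← hW, hcub]
        exact L.smul_mem _ (hLΘ i j)
      · rw [← hW, hcub, map_smul, contract_ghostCoframe]
        exact L.smul_mem _ (L.sum_mem fun a _ => L.smul_mem _ (hLΘ' i j a))
    rw [hLdef] at hωL
    obtain ⟨_, ⟨η, rfl⟩, y, hy, rfl⟩ := Submodule.mem_sup.mp hωL
    obtain ⟨x, hx, _, ⟨p₀, rfl⟩, rfl⟩ := Submodule.mem_sup.mp hy
    obtain ⟨z, hz, y₁, hy₁, rfl⟩ := Submodule.mem_sup.mp hx
    obtain ⟨y₃, hy₃, y₂, hy₂, rfl⟩ := Submodule.mem_sup.mp hz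
    obtain ⟨p₃, rfl⟩ := (Submodule.mem_span_range_iff_exists_fun _).mp hy₃
    obtain ⟨p₂, rfl⟩ := (Submodule.mem_span_range_iff_exists_fun _).mp hy₂
    obtain ⟨p₁, rfl⟩ := (Submodule.mem_span_range_iff_exists_fun _).mp hy₁
    refine ⟨fun i j => p₃ (i, j), fun i j a => p₂ ((i, j), a), fun i α => p₁ (i, α), p₀, η, ?_⟩
    simp only [Fintype.sum_prod_type, Algebra.linearMap_apply]
    abel
  · rintro ⟨p₃, p₂, p₁, p₀, η, hη⟩
    rw [sub_eq_iff_eq_add] at hη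
    rw [hη]
    simp only [map_add, map_sum, map_smul, hbb, hΘcyc, hΘ'cyc, hθcyc, h0cyc, smul_zero,
      Finset.sum_const_zero, add_zero]

end SpinorRep

end

end

end SusyCohomology

/-- `ε = 1` is the case `(N₊, N₋) = (2, 0)` and `ε = -1` is the case `(N₊, N₋) = (0, 2)`. -/
theorem mainTheorem6 (t : ℕ) (ht : t = 1 ∨ t = 3 ∨ t = 5) (G : SpinorRep t) (ε : ℤˣ)
    (e : Module.Basis (Fin 4) ℂ (G.weylSpinors ε)) (ω : GhostAlgebra) :
    cobdry e ω = 0 ↔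
      ∃ (p₃ : Fin 2 → Fin 2 → GhostPoly) (p₂ : Fin 2 → Fin 2 → Fin 6 → GhostPoly)
        (p₁ : Fin 2 → Fin 8 → GhostPoly) (p₀ : GhostPoly),
        Equivalent e ω
          ((∑ i, ∑ j, p₃ i j • Theta e 3 i j) +
            (∑ i, ∑ j, ∑ a, p₂ i j a • ThetaDeriv e 3 i j a) +
            (∑ i, ∑ α, p₁ i α • vartheta e i α) +
            algebraMap GhostPoly GhostAlgebra p₀) := by
  exact SusyCohomology.SpinorRep.cobdry_eq_zero_iff e ω
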